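/- Let $\gamma\in\mathbb R$ with $|\gamma|<1$. On the complex Hilbert space $L^2(\mathbb R)$ consider the operators $$H_{ho}=-\frac14\frac{d^2}{dx^2}+x^2,\qquad V=-\gamma\Big(\frac12+x\frac{d}{dx}\Big),\qquad H=H_{ho}+V=-\frac14\frac{d^2}{dx^2}+x^2-\gamma\Big(\frac12+x\frac{d}{dx}\Big),$$ where derivatives are weak derivatives, each operator is defined on all $\psi\in L^2(\mathbb R)$ for which every term is in $L^2(\mathbb R)$ ($V$ on those $\psi$ with $\psi',\,x\psi'\in L^2(\mathbb R)$; $H_{ho}$ on $\mathcal D$ below; $H$ on $\mathcal D(H_{ho})\cap\mathcal D(V)$), and $$\mathcal D=\{\psi\in L^2(\mathbb R):\ \psi',\psi''\in L^2(\mathbb R),\ x^2\psi\in L^2(\mathbb R)\}.$$ Then: 1. the domain of $H$ is $\mathcal D$, it is dense in $L^2(\mathbb R)$, and $\operatorname{Re}(H):=\frac12(H+H^*)$, with domain $\mathcal D(H)\cap\mathcal D(H^*)$, equals $H_{ho}$; 2. the non-Hermitian part $V$ is relatively bounded with respect to $\operatorname{Re}(H)$, with relative bound less than $1$; that is, $\mathcal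 D(\operatorname{Re}(H))\subseteq\mathcal D(V)$, and the infimum of the $a\ge0$ for which there is a $b\ge0$ with $\|V\psi\|\le a\|\operatorname{Re}(H)\psi\|+b\|\psi\|$ for all $\psi\in\mathcal D(\operatorname{Re}(H))$ is less than $1$ (the set of such $a$ being non-empty); 3. $H$ is closed and has compact resolvent: for some $\lambda\in\rho(H)$ the operator $(H-\lambda)^{-1}$ is compact; 4. $\sigma(H)=\sigma_p(H)$, where $\sigma(H)$ is the complement of the set $\rho(H)$ of those $\lambda\in\mathbb C$ for which $(H-\lambda)^{-1}$ exists as a bounded operator on $L^2(\mathbb R)$, and $\sigma_p(H)$ is the set of eigenvalues of $H$; moreover the spectrum of $H$ is purely discrete: every point of $\sigma(H)$ is an isolated point of $\sigma(H)$ and an eigenvalue of finite algebraic multiplicity, i.e. $\bigcup_n\ker(H-\lambda)^n$ is finite-dimensional. -/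

import Mathlib

open MeasureTheory Topology
open scoped ContDiff

noncomputable section

namespace Swanson

/-- The complex Hilbert space `L²(ℝ)`. -/
abbrev L2 : Type := Lp ℂ 2 (volume : Measure ℝ)

/-! ### Weak derivatives -/

/-- `g` is the weak derivative of `f`: `∫ φ' f = -∫ φ g` for all test functions `φ ∈ C_c^∞(ℝ)`. -/
def IsWeakDeriv (f g : ℝ → ℂ) : Prop :=
  ∀ φ : ℝ → ℝ, ContDiff ℝ ∞ φ → HasCompactSupport φ →
    ∫ x, deriv φ x • f x = -∫ x, φ x • g x

theorem integrable_test_smul {φ : ℝ → ℝ} (hφ : Continuous φ) (hc : HasCompactSupport φ) (f : L2) :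
    Integrable (fun x => φ x • f x) :=
  ((Lp.memLp f).locallyIntegrable one_le_two).integrable_smul_left_of_hasCompactSupport hφ hc

/-- The pairs `(f, f')` with `f ∈ L²(ℝ)` and weak derivative `f' ∈ L²(ℝ)`. -/
def weakDerivGraph : Submodule ℂ (L2 × L2) where
  carrier := {p | IsWeakDeriv p.1 p.2}
  zero_mem' := by
    intro φ _ _
    have h : ((0 : L2) : ℝ → ℂ) =ᵐ[volume] 0 := Lp.coeFn_zero _ _ _
    have h1 : ∫ x, deriv φ x • ((0 : L2) : ℝ → ℂ) x = 0 := by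
      rw [integral_congr_ae (g := fun _ => (0 : ℂ)) (by filter_upwards [h] with x hx; simp)]
      simp
    have h2 : ∫ x, φ x • ((0 : L2) : ℝ → ℂ) x = 0 := by
      rw [integral_congr_ae (g := fun _ => (0 : ℂ)) (by filter_upwards [h] with x hx; simp)]
      simp
    change ∫ x, deriv φ x • ((0 : L2) : ℝ → ℂ) x = -∫ x, φ x • ((0 : L2) : ℝ → ℂ) x
    rw [h1, h2, neg_zero]
  add_mem' := by
    intro p q hp hq φ hφ hc
    have hd : Continuous (deriv φ) := hφ.continuous_deriv (by simp)
    have key : ∀ (ψ : ℝ → ℝ), Continuous ψ → HasCompactSupport ψ → ∀ a b : L2,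
        ∫ x, ψ x • (a + b : L2) x = (∫ x, ψ x • a x) + ∫ x, ψ x • b x := by
      intro ψ h1 h2 a b
      rw [← integral_add (integrable_test_smul h1 h2 a) (integrable_test_smul h1 h2 b)]
      refine integral_congr_ae ?_
      filter_upwards [Lp.coeFn_add a b] with x hx
      rw [hx, Pi.add_apply]
      simp
    change ∫ x, deriv φ x • (p.1 + q.1 : L2) x = -∫ x, φ x • (p.2 + q.2 : L2) x
    rw [key _ hd hc.deriv, key _ hφ.continuous hc, hp φ hφ hc, hq φ hφ hc]
    ring
  smul_mem' := by
    intro c p hp φ hφ hc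
    have key : ∀ (ψ : ℝ → ℝ) (a : L2),
        ∫ x, ψ x • (c • a : L2) x = c * ∫ x, ψ x • a x := by
      intro ψ a
      rw [← integral_const_mul]
      refine integral_congr_ae ?_
      filter_upwards [Lp.coeFn_smul c a] with x hx
      rw [hx, Pi.smul_apply]
      simp
      ring
    change ∫ x, deriv φ x • (c • p.1 : L2) x = -∫ x, φ x • (c • p.2 : L2) x
    rw [key, key, hp φ hφ hc]
    ring

/-- Weak derivatives are unique, so `weakDerivGraph` is the graph of an operator. -/
theorem weakDerivGraph_functional (p : L2 × L2) (hp : p ∈ weakDerivGraph) (h0 : p.1 = 0) :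
    p.2 = 0 := by
  have hz : (p.2 : ℝ → ℂ) =ᵐ[volume] 0 := by
    refine ae_eq_zero_of_integral_contDiff_smul_eq_zero
      ((Lp.memLp p.2).locallyIntegrable one_le_two) ?_
    intro φ hφ hc
    have h1 := hp φ hφ hc
    have h2 : ∫ x, deriv φ x • (p.1 : ℝ → ℂ) x = 0 := by
      rw [h0, integral_congr_ae (g := fun _ => (0 : ℂ))
        (by filter_upwards [Lp.coeFn_zero ℂ 2 (volume : Measure ℝ)] with x hx; simp)]
      simp
    rw [h2] at h1
    exact neg_eq_zero.mp h1.symm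
  exact (Lp.eq_zero_iff_ae_eq_zero).2 hz

/-- `d/dx` on `L²(ℝ)`, with domain all `f ∈ L²(ℝ)` whose weak derivative is in `L²(ℝ)`. -/
def ddx : L2 →ₗ.[ℂ] L2 := weakDerivGraph.toLinearPMap

theorem ddx_graph : ddx.graph = weakDerivGraph :=
  Submodule.toLinearPMap_graph_eq _ weakDerivGraph_functional

theorem mem_ddx_domain_iff (f : L2) : f ∈ ddx.domain ↔ ∃ g : L2, IsWeakDeriv f g := by
  rw [LinearPMap.mem_domain_iff, ddx_graph]
  rfl

theorem isWeakDeriv_ddx (f : ddx.domain) : IsWeakDeriv (f : L2) (ddx f) :=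
  Submodule.mem_graph_toLinearPMap weakDerivGraph_functional f

/-! ### Multiplication operators and composition -/

/-- Multiplication by a real function `w` on `L²(ℝ)`, with its maximal domain
`{f ∈ L²(ℝ) : w f ∈ L²(ℝ)}`. -/
def mulOp (w : ℝ → ℝ) : L2 →ₗ.[ℂ] L2 where
  domain :=
    { carrier := {f | MemLp (fun x => (w x : ℂ) * f x) 2 volume}
      zero_mem' := by
        refine (MemLp.zero (p := 2) (μ := volume) (ε := ℂ) (α := ℝ)).ae_eq ?_
        filter_upwards [Lp.coeFn_zero ℂ 2 (volume : Measure ℝ)] with x hx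
        simp
      add_mem' := by
        intro f g hf hg
        refine (MemLp.add hf hg).ae_eq ?_
        filter_upwards [Lp.coeFn_add f g] with x hx
        rw [hx, Pi.add_apply]
        simp [mul_add]
      smul_mem' := by
        intro c f hf
        refine (MemLp.const_smul hf c).ae_eq ?_
        filter_upwards [Lp.coeFn_smul c f] with x hx
        rw [hx, Pi.smul_apply, smul_eq_mul]
        simp
        ring }
  toFun :=
    { toFun := fun f => MemLp.toLp (fun x => (w x : ℂ) * (f : L2) x) f.2
      map_add' := by
        intro f g
        rw [← MemLp.toLp_add, MemLp.toLp_eq_toLp_iff]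
        filter_upwards [Lp.coeFn_add (f : L2) (g : L2)] with x hx
        rw [Submodule.coe_add, hx, Pi.add_apply, Pi.add_apply]
        ring
      map_smul' := by
        intro c f
        rw [RingHom.id_apply, ← MemLp.toLp_const_smul, MemLp.toLp_eq_toLp_iff]
        filter_upwards [Lp.coeFn_smul c (f : L2)] with x hx
        rw [Submodule.coe_smul, hx, Pi.smul_apply, Pi.smul_apply, smul_eq_mul, smul_eq_mul]
        ring }

/-- The composition `B A` of partially defined operators, with its natural domain
`{f ∈ D(A) : A f ∈ D(B)}`. -/
def pcomp (B A : L2 →ₗ.[ℂ] L2) : L2 →ₗ.[ℂ] L2 :=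
  B.comp (A.domRestrict ((B.domain.comap A.toFun).map A.domain.subtype)) (by
    rintro ⟨f, hf, hA⟩
    obtain ⟨⟨g, hg⟩, hgB, rfl⟩ := hf
    exact hgB)

theorem mem_pcomp_domain_iff (B A : L2 →ₗ.[ℂ] L2) (f : L2) :
    f ∈ (pcomp B A).domain ↔ ∃ h : f ∈ A.domain, A ⟨f, h⟩ ∈ B.domain := by
  constructor
  · rintro ⟨⟨⟨g, hg⟩, hgB, rfl⟩, hA⟩
    exact ⟨hg, hgB⟩
  · rintro ⟨h, hB⟩
    exact ⟨⟨⟨f, h⟩, hB, rfl⟩, h⟩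

theorem pcomp_apply (B A : L2 →ₗ.[ℂ] L2) (f : L2) (hf : f ∈ (pcomp B A).domain)
    (hA : f ∈ A.domain) (hB : A ⟨f, hA⟩ ∈ B.domain) :
    pcomp B A ⟨f, hf⟩ = B ⟨A ⟨f, hA⟩, hB⟩ := rfl

/-! ### The model -/

/-- The identity operator on `L²(ℝ)`. -/
def one : L2 →ₗ.[ℂ] L2 := (LinearMap.id : L2 →ₗ[ℂ] L2).toPMap ⊤

/-- The harmonic oscillator `-(1/4) d²/dx² + x²`. -/
def oscillator : L2 →ₗ.[ℂ] L2 :=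
  (-(1 / 4) : ℂ) • pcomp ddx ddx + mulOp (fun x => x ^ 2)

/-- The non-Hermitian term `V = -γ (1/2 + x d/dx)`. -/
def pert (γ : ℝ) : L2 →ₗ.[ℂ] L2 :=
  (-γ : ℂ) • ((1 / 2 : ℂ) • one + pcomp (mulOp (fun x => x)) ddx)

/-- The Hamiltonian `H = -(1/4) d²/dx² + x² - γ (1/2 + x d/dx)`, on all `f` for which each term
makes sense in `L²(ℝ)`. -/
def hamiltonian (γ : ℝ) : L2 →ₗ.[ℂ] L2 := oscillator + pert γ

/-- The space `D = {ψ ∈ L²(ℝ) : ψ', ψ'' ∈ L²(ℝ) (weak derivatives), x² ψ ∈ L²(ℝ)}`. -/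
def domD : Set L2 :=
  {f | (∃ f' f'' : L2, IsWeakDeriv f f' ∧ IsWeakDeriv f' f'') ∧
    MemLp (fun x : ℝ => ((x ^ 2 : ℝ) : ℂ) * f x) 2 volume}

theorem oscillator_domain : (oscillator.domain : Set L2) = domD := by
  ext f
  change f ∈ (pcomp ddx ddx).domain ⊓ (mulOp (fun x => x ^ 2)).domain ↔ _
  rw [Submodule.mem_inf, mem_pcomp_domain_iff]
  refine and_congr ?_ Iff.rfl
  constructor
  · rintro ⟨h, h2⟩
    obtain ⟨g, hg⟩ := (mem_ddx_domain_iff _).1 h2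
    exact ⟨ddx ⟨f, h⟩, g, isWeakDeriv_ddx ⟨f, h⟩, hg⟩
  · rintro ⟨f', f'', h1, h2⟩
    have h : f ∈ ddx.domain := (mem_ddx_domain_iff f).2 ⟨f', h1⟩
    refine ⟨h, ?_⟩
    have hd := isWeakDeriv_ddx ⟨f, h⟩
    have he : ddx ⟨f, h⟩ = f' := by
      have := weakDerivGraph_functional ((f, ddx ⟨f, h⟩) - (f, f'))
        (weakDerivGraph.sub_mem hd h1) (by simp)
      simpa [sub_eq_zero] using this
    rw [he]
    exact (mem_ddx_domain_iff f').2 ⟨f'', h2⟩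

/-! ### Notions for unbounded operators -/

/-- The real part `Re A = (A + A*) / 2`, on `D(A) ∩ D(A*)`. -/
def realPart (A : L2 →ₗ.[ℂ] L2) : L2 →ₗ.[ℂ] L2 := (1 / 2 : ℂ) • (A + A.adjoint)

/-- `a ≥ 0` is an admissible constant in `‖B f‖ ≤ a ‖A f‖ + b ‖f‖` for `f ∈ D(A) ⊆ D(B)`,
for some `b ≥ 0`. -/
def BoundedWith (B A : L2 →ₗ.[ℂ] L2) (a : ℝ) : Prop :=
  0 ≤ a ∧ ∃ b : ℝ, 0 ≤ b ∧ ∀ (f : L2) (hA : f ∈ A.domain) (hB : f ∈ B.domain),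
    ‖B ⟨f, hB⟩‖ ≤ a * ‖A ⟨f, hA⟩‖ + b * ‖f‖

/-- `B` is relatively bounded with respect to `A`. -/
def RelativelyBounded (B A : L2 →ₗ.[ℂ] L2) : Prop :=
  A.domain ≤ B.domain ∧ ∃ a : ℝ, BoundedWith B A a

/-- The relative bound of `B` with respect to `A`: the infimum of the admissible constants. -/
def relativeBound (B A : L2 →ₗ.[ℂ] L2) : ℝ := sInf {a : ℝ | BoundedWith B A a}

/-- `R` is the bounded, everywhere defined inverse `(A - z)⁻¹`. -/
def IsResolventAt (A : L2 →ₗ.[ℂ] L2) (z : ℂ) (R : L2 →L[ℂ] L2) : Prop :=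
  (∀ u : L2, ∃ h : R u ∈ A.domain, A ⟨R u, h⟩ - z • R u = u) ∧
    ∀ f : A.domain, R (A f - z • (f : L2)) = f

/-- The resolvent set `ρ(A)`. -/
def resolventSet (A : L2 →ₗ.[ℂ] L2) : Set ℂ := {z | ∃ R : L2 →L[ℂ] L2, IsResolventAt A z R}

/-- The spectrum `σ(A) = ℂ \ ρ(A)`. -/
def spec (A : L2 →ₗ.[ℂ] L2) : Set ℂ := (resolventSet A)ᶜ

/-- The point spectrum `σ_p(A)`: the set of eigenvalues of `A`. -/
def pointSpec (A : L2 →ₗ.[ℂ] L2) : Set ℂ :=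
  {z | ∃ f : A.domain, (f : L2) ≠ 0 ∧ A f = z • (f : L2)}

/-- `A` has a compact resolvent: `(A - z)⁻¹` is compact for some `z ∈ ρ(A)`. -/
def HasCompactResolvent (A : L2 →ₗ.[ℂ] L2) : Prop :=
  ∃ (z : ℂ) (R : L2 →L[ℂ] L2), IsResolventAt A z R ∧ IsCompactOperator R

/-- The kernel of `(A - z)ⁿ`: `f ∈ ker (A - z)ⁿ⁺¹` iff `f ∈ D(A)` and
`(A - z) f ∈ ker (A - z)ⁿ`. -/
def kerPow (A : L2 →ₗ.[ℂ] L2) (z : ℂ) : ℕ → Submodule ℂ L2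
  | 0 => ⊥
  | n + 1 => ((kerPow A z n).comap (A.toFun - z • A.domain.subtype)).map A.domain.subtype

/-- The algebraic eigenspace `⋃ₙ ker (A - z)ⁿ`, whose dimension is the algebraic multiplicity. -/
def rootSpace (A : L2 →ₗ.[ℂ] L2) (z : ℂ) : Submodule ℂ L2 := ⨆ n, kerPow A z n

/-- The spectrum of `A` is purely discrete: it consists of isolated points which are eigenvalues
of finite algebraic multiplicity. -/
def HasPurelyDiscreteSpectrum (A : L2 →ₗ.[ℂ] L2) : Prop :=
  ∀ z ∈ spec A, (∃ ε > 0, ∀ w ∈ spec A, ‖w - z‖ < ε → w = z) ∧ z ∈ pointSpec A ∧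
    FiniteDimensional ℂ (rootSpace A z)

end Swanson

end

/-!
Write `D = d/dx`. Everything is reduced to algebra on the functions `P(x) e^{-c x²}` with `P` a
polynomial and `c > 0`, on which `D` acts by `P ↦ P' - 2 c x P` (`gaussPoly`, `gaussDeriv`). They
are legitimate test functions for the weak derivative of any `L²` function
(`IsWeakDeriv.inner_gaussPoly`), and they are complete, because orthogonality of `f` to all of
them forces the Fourier transform of `f(x) e^{-c x²}` to vanish
(`eq_zero_of_inner_gaussPoly_eq_zero`).

For `c = 1` the Hermite functions are among them, so they form a Hilbert basis of eigenfunctions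
of `H_ho`, and testing `H_ho f` against this basis shows that the Hermite expansion of any `f` in
the domain converges in the graph norm (`exists_tendsto_gaussPoly`). Conversely, the commutator
identity `‖H_ho s‖² = ‖D² s‖² / 16 + ‖x² s‖² + ‖x D s‖² / 2 - ‖s‖² / 2` shows that every single
term converges whenever `s` and `H_ho s` do (`oscillator_of_tendsto`). So identities and
estimates proved for polynomials pass to the whole domain. Among them are the antisymmetry of
`V`, which yields `Re H = H_ho`, and `‖V f‖² ≤ γ² (‖H_ho f‖² + ‖f‖²)`, whose leading part comes
from `(ξ²/4 + x²)² - x² ξ² = (ξ²/4 - x²)²`; it bounds the relative bound by `|γ|`.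

The inverse `R₁ = (H_ho + 1)⁻¹` is diagonal in the Hermite basis, hence compact, and
`‖V R₁‖ ≤ |γ| < 1`; thus `(H + 1)⁻¹ = R₁ (1 + V R₁)⁻¹` is compact
(`hasCompactResolvent_hamiltonian`), `H` is closed, and by the Fredholm alternative its spectrum
consists of eigenvalues. Finally, with `ω² = 1 + γ²`, the formal adjoint `H_{-γ}` has the
eigenvalues `ω (n + 1/2)` with eigenfunctions a Hermite polynomial times `e^{-(ω - γ) x²}`, again
a complete family (`exists_complete_adjoint_eigenfunctions`). Testing an eigenfunction of `H`
against it shows that there are no further eigenvalues, and testing a generalized eigenfunction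
shows that it is orthogonal to all but one member of the family, so that each algebraic
eigenspace is at most one-dimensional.
-/

noncomputable section

namespace Swanson

open Polynomial Filter

/-! ### Gaussians times polynomials -/

theorem contDiff_exp_neg_mul_sq (c : ℝ) : ContDiff ℝ ∞ (fun x : ℝ => Real.exp (-c * x ^ 2)) := by
  fun_prop

theorem memLp_pow_mul_exp {c : ℝ} (hc : 0 < c) (n : ℕ) :
    MemLp (fun x : ℝ => x ^ n * Real.exp (-c * x ^ 2)) 2 volume := by
  rw [memLp_two_iff_integrable_sq_norm (Continuous.aestronglyMeasurable (by fun_prop))]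
  have h := integrable_rpow_mul_exp_neg_mul_sq (b := 2 * c) (by positivity)
    (s := ((2 * n : ℕ) : ℝ)) (by push_cast; linarith [n.cast_nonneg (α := ℝ)])
  refine h.congr (Eventually.of_forall fun x => ?_)
  simp only [Real.norm_eq_abs, sq_abs, Real.rpow_natCast, mul_pow, ← Real.exp_nat_mul]
  congr 1
  · ring
  · congr 1
    push_cast
    ring

theorem memLp_eval_mul_exp {c : ℝ} (hc : 0 < c) (P : ℂ[X]) :
    MemLp (fun x : ℝ => P.eval (x : ℂ) * (Real.exp (-c * x ^ 2) : ℂ)) 2 volume := by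
  induction P using Polynomial.induction_on' with
  | add P Q hP hQ =>
    refine (hP.add hQ).ae_eq (Eventually.of_forall fun x => ?_)
    simp [add_mul]
  | monomial n a =>
    refine ((memLp_pow_mul_exp hc n).ofReal (K := ℂ)).const_mul a |>.ae_eq
      (Eventually.of_forall fun x => ?_)
    simp [mul_assoc]

/-- The function `P(x) e^{-c x²}` as an element of `L²(ℝ)`, linear in the polynomial `P`. -/
def gaussPoly {c : ℝ} (hc : 0 < c) : ℂ[X] →ₗ[ℂ] L2 where
  toFun P := (memLp_eval_mul_exp hc P).toLp _
  map_add' P Q := by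
    rw [← MemLp.toLp_add, MemLp.toLp_eq_toLp_iff]
    exact Eventually.of_forall fun x => by simp [add_mul]
  map_smul' a P := by
    rw [RingHom.id_apply, ← MemLp.toLp_const_smul, MemLp.toLp_eq_toLp_iff]
    exact Eventually.of_forall fun x => by simp [mul_assoc]

theorem coeFn_gaussPoly {c : ℝ} (hc : 0 < c) (P : ℂ[X]) :
    gaussPoly hc P =ᵐ[volume] fun x : ℝ => P.eval (x : ℂ) * (Real.exp (-c * x ^ 2) : ℂ) :=
  MemLp.coeFn_toLp (memLp_eval_mul_exp hc P)

theorem gaussPoly_injective {c : ℝ} (hc : 0 < c) : Function.Injective (gaussPoly hc) := by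
  rw [injective_iff_map_eq_zero]
  intro P hP
  have h0 : (fun x : ℝ => P.eval (x : ℂ) * (Real.exp (-c * x ^ 2) : ℂ)) =ᵐ[volume] fun _ => 0 := by
    refine (coeFn_gaussPoly hc P).symm.trans ?_
    rw [hP]
    exact Lp.coeFn_zero _ _ _
  have h1 := (Continuous.ae_eq_iff_eq volume (by fun_prop) continuous_const).1 h0
  refine P.eq_zero_of_infinite_isRoot
    ((Set.infinite_range_of_injective Complex.ofReal_injective).mono ?_)
  rintro _ ⟨x, rfl⟩
  have := congrFun h1 x
  simpa using this

/-- The action of `d/dx` on the polynomial factor of `P(x) e^{-c x²}`. -/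
def gaussDeriv (c : ℝ) : ℂ[X] →ₗ[ℂ] ℂ[X] :=
  Polynomial.derivative - LinearMap.mulLeft ℂ (C (2 * c : ℂ) * X)

theorem gaussDeriv_apply (c : ℝ) (P : ℂ[X]) :
    gaussDeriv c P = derivative P - C (2 * c : ℂ) * X * P := rfl

theorem gaussDeriv_X_mul (c : ℝ) (P : ℂ[X]) :
    gaussDeriv c (X * P) = P + X * gaussDeriv c P := by
  simp only [gaussDeriv_apply, derivative_mul, derivative_X]
  ring

theorem hasDerivAt_eval_mul_exp (c : ℝ) (P : ℂ[X]) (x : ℝ) :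
    HasDerivAt (fun x : ℝ => P.eval (x : ℂ) * (Real.exp (-c * x ^ 2) : ℂ))
      ((gaussDeriv c P).eval (x : ℂ) * (Real.exp (-c * x ^ 2) : ℂ)) x := by
  have h1 : HasDerivAt (fun x : ℝ => P.eval (x : ℂ)) ((derivative P).eval (x : ℂ)) x :=
    (P.hasDerivAt (x : ℂ)).comp_ofReal
  have h2 : HasDerivAt (fun x : ℝ => Real.exp (-c * x ^ 2))
      (Real.exp (-c * x ^ 2) * (-c * (2 * x))) x := by
    simpa using ((hasDerivAt_pow 2 x).const_mul (-c)).exp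
  refine (h1.mul h2.ofReal_comp).congr_deriv ?_
  simp [gaussDeriv_apply]
  ring

theorem isWeakDeriv_gaussPoly {c : ℝ} (hc : 0 < c) (P : ℂ[X]) :
    IsWeakDeriv (gaussPoly hc P) (gaussPoly hc (gaussDeriv c P)) := by
  intro φ hφ hs
  have hφc : ∀ ψ : ℝ → ℝ, Continuous ψ → HasCompactSupport ψ → ∀ Q : ℂ[X],
      Integrable (fun x : ℝ => (ψ x : ℂ) * (Q.eval (x : ℂ) * (Real.exp (-c * x ^ 2) : ℂ))) := by
    intro ψ h1 h2 Q
    refine (integrable_test_smul h1 h2 (gaussPoly hc Q)).congr ?_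
    filter_upwards [coeFn_gaussPoly hc Q] with x hx
    rw [hx, Complex.real_smul]
  have hd : Continuous (deriv φ) := hφ.continuous_deriv (by simp)
  have key := integral_mul_deriv_eq_deriv_mul_of_integrable (A := ℂ)
    (u := fun x => (φ x : ℂ)) (u' := fun x => ((deriv φ x : ℝ) : ℂ))
    (v := fun x : ℝ => P.eval (x : ℂ) * (Real.exp (-c * x ^ 2) : ℂ))
    (v' := fun x : ℝ => (gaussDeriv c P).eval (x : ℂ) * (Real.exp (-c * x ^ 2) : ℂ))
    (fun x _ => ((hφ.differentiable (by simp)) x).hasDerivAt.ofReal_comp)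
    (fun x _ => hasDerivAt_eval_mul_exp c P x)
    (hφc φ hφ.continuous hs _) (hφc _ hd hs.deriv _) (hφc φ hφ.continuous hs _)
  rw [integral_congr_ae (g := fun x => ((deriv φ x : ℝ) : ℂ) *
      (P.eval (x : ℂ) * (Real.exp (-c * x ^ 2) : ℂ))),
    integral_congr_ae (f := fun x => φ x • gaussPoly hc (gaussDeriv c P) x)
      (g := fun x => (φ x : ℂ) *
      ((gaussDeriv c P).eval (x : ℂ) * (Real.exp (-c * x ^ 2) : ℂ))), key, neg_neg]
  · filter_upwards [coeFn_gaussPoly hc (gaussDeriv c P)] with x hx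
    rw [hx, Complex.real_smul]
  · filter_upwards [coeFn_gaussPoly hc P] with x hx
    rw [hx, Complex.real_smul]

/-! ### Integration by parts against Gaussians -/

/-- Test functions for weak derivatives of `L²` functions need not have compact support: it is
enough that `w` and `w'` are square integrable. The cutoffs `χ(x/n) w(x)` converge to `w`. -/
theorem IsWeakDeriv.integral_smul_of_memLp {f g : L2} (h : IsWeakDeriv f g) {w : ℝ → ℝ}
    (hw : ContDiff ℝ ∞ w) (h1 : MemLp w 2 volume) (h2 : MemLp (deriv w) 2 volume) :
    ∫ x, deriv w x • f x = -∫ x, w x • g x := by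
  let χ : ContDiffBump (0 : ℝ) := ⟨1, 2, one_pos, one_lt_two⟩
  have hχ : ContDiff ℝ ∞ χ := χ.contDiff
  have hχd : Continuous (deriv χ) := hχ.continuous_deriv (by simp)
  obtain ⟨C, hC⟩ := χ.hasCompactSupport.deriv.exists_bound_of_continuous hχd
  have hwd : Continuous (deriv w) := hw.continuous_deriv (by simp)
  let s : ℕ → ℝ := fun n => ((n : ℝ) + 1)⁻¹
  have hs0 : ∀ n, 0 < s n := fun n => by positivity
  have hs1 : ∀ n, s n ≤ 1 := fun n => inv_le_one_of_one_le₀ (by simp)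
  have hs : Tendsto s atTop (𝓝 0) := tendsto_inv_atTop_zero.comp
    (tendsto_atTop_add_const_right _ _ tendsto_natCast_atTop_atTop)
  let φ : ℕ → ℝ → ℝ := fun n x => χ (s n * x) * w x
  have hχs : ∀ n x, HasDerivAt (fun x => χ (s n * x)) (deriv χ (s n * x) * s n) x := by
    intro n x
    have := ((hχ.differentiable (by simp)) (s n * x)).hasDerivAt.comp x
      ((hasDerivAt_id x).const_mul (s n))
    simpa [Function.comp_def] using this
  have hφd : ∀ n x, deriv (φ n) x = deriv χ (s n * x) * s n * w x + χ (s n * x) * deriv w x :=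
    fun n x => ((hχs n x).mul ((hw.differentiable (by simp)) x).hasDerivAt).deriv
  have hφsm : ∀ n, ContDiff ℝ ∞ (φ n) := fun n =>
    (hχ.comp (contDiff_const.mul contDiff_id)).mul hw
  have hφs : ∀ n, HasCompactSupport (φ n) := fun n =>
    (χ.hasCompactSupport.comp_homeomorph
      (Homeomorph.mulLeft₀ (s n) (hs0 n).ne')).mul_right
  have hlim : ∀ x, Tendsto (fun n => χ (s n * x)) atTop (𝓝 1) := by
    intro x
    have h3 : Tendsto (fun n => s n * x) atTop (𝓝 0) := by simpa using hs.mul_const x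
    have h4 := (hχ.continuous.tendsto 0).comp h3
    rwa [χ.one_of_mem_closedBall (by simp [χ])] at h4
  have hχ1 : ∀ x, |χ x| ≤ 1 := fun x => by
    rw [abs_of_nonneg χ.nonneg]; exact χ.le_one
  have T1 : Tendsto (fun n => ∫ x, φ n x • g x) atTop (𝓝 (∫ x, w x • g x)) := by
    refine tendsto_integral_of_dominated_convergence (fun x => ‖w x‖ * ‖g x‖)
      (fun n => (hφsm n).continuous.aestronglyMeasurable.smul (Lp.aestronglyMeasurable g))
      (h1.norm.integrable_mul (Lp.memLp g).norm)
      (fun n => Eventually.of_forall fun x => ?_) (Eventually.of_forall fun x => ?_)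
    · rw [norm_smul, norm_mul]
      gcongr
      calc _ ≤ 1 * ‖w x‖ := by gcongr; exact hχ1 _
        _ = _ := one_mul _
    · simpa [φ] using ((hlim x).mul_const (w x)).smul_const (g x)
  have T2 : Tendsto (fun n => ∫ x, deriv (φ n) x • f x) atTop (𝓝 (∫ x, deriv w x • f x)) := by
    refine tendsto_integral_of_dominated_convergence
      (fun x => C * (‖w x‖ * ‖f x‖) + ‖deriv w x‖ * ‖f x‖)
      (fun n => ((hφsm n).continuous_deriv (by simp)).aestronglyMeasurable.smul
        (Lp.aestronglyMeasurable f))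
      (((h1.norm.integrable_mul (Lp.memLp f).norm).const_mul C).add
        (h2.norm.integrable_mul (Lp.memLp f).norm))
      (fun n => Eventually.of_forall fun x => ?_) (Eventually.of_forall fun x => ?_)
    · rw [norm_smul, hφd, ← mul_assoc, ← add_mul]
      gcongr
      refine (norm_add_le _ _).trans (add_le_add ?_ ?_)
      · rw [norm_mul, norm_mul]
        gcongr
        calc _ ≤ C * 1 := by
              gcongr
              · exact (norm_nonneg _).trans (hC 0)
              · exact hC _
              · rw [Real.norm_eq_abs, abs_of_pos (hs0 n)]; exact hs1 n
          _ = C := mul_one C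
      · rw [norm_mul]
        calc _ ≤ 1 * ‖deriv w x‖ := by gcongr; exact hχ1 _
          _ = _ := one_mul _
    · have h5 : Tendsto (fun n => deriv χ (s n * x) * s n) atTop (𝓝 0) := by
        refine squeeze_zero_norm (a := fun n => C * s n) (fun n => ?_)
          (by simpa using hs.const_mul C)
        rw [norm_mul, Real.norm_eq_abs (s n), abs_of_pos (hs0 n)]
        exact mul_le_mul_of_nonneg_right (hC _) (hs0 n).le
      have h6 := (h5.mul_const (w x)).add ((hlim x).mul_const (deriv w x))
      simp only [hφd]
      simpa using h6.smul_const (f x)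
  refine tendsto_nhds_unique T2 ?_
  have : ∀ n, ∫ x, deriv (φ n) x • f x = -∫ x, φ n x • g x := fun n => h _ (hφsm n) (hφs n)
  simp only [this]
  exact T1.neg

theorem inner_gaussPoly_X_pow {c : ℝ} (hc : 0 < c) (n : ℕ) (f : L2) :
    inner ℂ (gaussPoly hc (X ^ n)) f = ∫ x : ℝ, (x ^ n * Real.exp (-c * x ^ 2)) • f x := by
  rw [L2.inner_def]
  refine integral_congr_ae ?_
  filter_upwards [coeFn_gaussPoly hc (X ^ n)] with x hx
  rw [hx, RCLike.inner_apply, Complex.real_smul, mul_comm]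
  simp only [eval_pow, eval_X, ← Complex.ofReal_pow, ← Complex.ofReal_mul, Complex.conj_ofReal]

/-- Two antilinear functionals of the polynomial `P` agree if they agree on monomials. -/
theorem inner_gaussPoly_congr {c : ℝ} (hc : 0 < c) {S T : ℂ[X] →ₗ[ℂ] ℂ[X]} {f g : L2}
    (h : ∀ n, inner ℂ (gaussPoly hc (S (X ^ n))) f = inner ℂ (gaussPoly hc (T (X ^ n))) g)
    (P : ℂ[X]) : inner ℂ (gaussPoly hc (S P)) f = inner ℂ (gaussPoly hc (T P)) g := by
  induction P using Polynomial.induction_on' with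
  | add P Q hP hQ => simp only [map_add, inner_add_left, hP, hQ]
  | monomial n a =>
    rw [← C_mul_X_pow_eq_monomial, ← smul_eq_C_mul]
    simp only [map_smul, inner_smul_left, h]

/-- Integration by parts against a Gaussian times a polynomial. -/
theorem IsWeakDeriv.inner_gaussPoly {f g : L2} (h : IsWeakDeriv f g) {c : ℝ} (hc : 0 < c)
    (P : ℂ[X]) :
    inner ℂ (gaussPoly hc P) g = -inner ℂ (gaussPoly hc (gaussDeriv c P)) f := by
  have key : ∀ n, inner ℂ (gaussPoly hc ((-gaussDeriv c) (X ^ n))) f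
      = inner ℂ (gaussPoly hc ((LinearMap.id : ℂ[X] →ₗ[ℂ] ℂ[X]) (X ^ n))) g := by
    intro n
    have hder : ∀ x : ℝ, HasDerivAt (fun x : ℝ => x ^ n * Real.exp (-c * x ^ 2))
        (n * (x ^ (n - 1) * Real.exp (-c * x ^ 2))
          - 2 * c * (x ^ (n + 1) * Real.exp (-c * x ^ 2))) x := by
      intro x
      have h2 : HasDerivAt (fun x : ℝ => Real.exp (-c * x ^ 2))
          (Real.exp (-c * x ^ 2) * (-c * (2 * x))) x := by
        simpa using ((hasDerivAt_pow 2 x).const_mul (-c)).exp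
      refine ((hasDerivAt_pow n x).mul h2).congr_deriv ?_
      ring
    have hd : deriv (fun x : ℝ => x ^ n * Real.exp (-c * x ^ 2)) = fun x : ℝ =>
        n * (x ^ (n - 1) * Real.exp (-c * x ^ 2))
          - 2 * c * (x ^ (n + 1) * Real.exp (-c * x ^ 2)) := funext fun x => (hder x).deriv
    have hI : ∀ m, Integrable (fun x : ℝ => (x ^ m * Real.exp (-c * x ^ 2)) • f x) := fun m =>
      memLp_one_iff_integrable.1 ((Lp.memLp f).smul (memLp_pow_mul_exp hc m))
    have hP := h.integral_smul_of_memLp (w := fun x => x ^ n * Real.exp (-c * x ^ 2))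
      ((contDiff_id.pow n).mul (contDiff_exp_neg_mul_sq c)) (memLp_pow_mul_exp hc n)
      (by rw [hd]; exact ((memLp_pow_mul_exp hc _).const_mul _).sub
            ((memLp_pow_mul_exp hc _).const_mul _))
    have hsplit : ∫ x, deriv (fun x : ℝ => x ^ n * Real.exp (-c * x ^ 2)) x • f x
        = (n : ℂ) * (∫ x : ℝ, (x ^ (n - 1) * Real.exp (-c * x ^ 2)) • f x)
          - (2 * c : ℂ) * ∫ x : ℝ, (x ^ (n + 1) * Real.exp (-c * x ^ 2)) • f x := by
      rw [hd, ← integral_const_mul, ← integral_const_mul,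
        ← integral_sub ((hI _).const_mul _) ((hI _).const_mul _)]
      refine integral_congr_ae (Eventually.of_forall fun x => ?_)
      simp only [Complex.real_smul]
      push_cast
      ring
    have hc2 : (starRingEnd ℂ) (2 * c) = 2 * c := by
      rw [map_mul, Complex.conj_ofReal, map_ofNat]
    rw [LinearMap.id_apply, inner_gaussPoly_X_pow, LinearMap.neg_apply, gaussDeriv_apply,
      derivative_X_pow, ← neg_eq_iff_eq_neg.2 hP, hsplit, mul_assoc, ← pow_succ']
    simp only [← smul_eq_C_mul, map_neg, map_sub, map_smul, inner_neg_left, inner_sub_left,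
      inner_smul_left, inner_gaussPoly_X_pow, hc2, Complex.conj_natCast]
  have h3 := inner_gaussPoly_congr hc key P
  simp only [LinearMap.neg_apply, map_neg, inner_neg_left, LinearMap.id_apply] at h3
  exact h3.symm

/-- Multiplication by `x` is symmetric against a Gaussian times a polynomial. -/
theorem inner_gaussPoly_mul_x {f g : L2} (h : g =ᵐ[volume] fun x : ℝ => (x : ℂ) * f x) {c : ℝ}
    (hc : 0 < c) (P : ℂ[X]) :
    inner ℂ (gaussPoly hc P) g = inner ℂ (gaussPoly hc (X * P)) f := by
  rw [L2.inner_def, L2.inner_def]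
  refine integral_congr_ae ?_
  filter_upwards [coeFn_gaussPoly hc P, coeFn_gaussPoly hc (X * P), h] with x h1 h2 h3
  rw [h1, h2, h3, RCLike.inner_apply, RCLike.inner_apply]
  simp
  ring

theorem gaussPoly_X_mul {c : ℝ} (hc : 0 < c) (P : ℂ[X]) :
    gaussPoly hc (X * P) =ᵐ[volume] fun x : ℝ => (x : ℂ) * gaussPoly hc P x := by
  filter_upwards [coeFn_gaussPoly hc P, coeFn_gaussPoly hc (X * P)] with x h1 h2
  rw [h1, h2]
  simp
  ring

theorem inner_gaussPoly_gaussDeriv {c : ℝ} (hc : 0 < c) (P Q : ℂ[X]) :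
    inner ℂ (gaussPoly hc P) (gaussPoly hc (gaussDeriv c Q))
      = -inner ℂ (gaussPoly hc (gaussDeriv c P)) (gaussPoly hc Q) :=
  (isWeakDeriv_gaussPoly hc Q).inner_gaussPoly hc P

theorem inner_gaussPoly_X_mul {c : ℝ} (hc : 0 < c) (P Q : ℂ[X]) :
    inner ℂ (gaussPoly hc P) (gaussPoly hc (X * Q))
      = inner ℂ (gaussPoly hc (X * P)) (gaussPoly hc Q) :=
  inner_gaussPoly_mul_x (gaussPoly_X_mul hc Q) hc P

/-! ### Completeness of Gaussians times polynomials -/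

open scoped FourierTransform in
/-- An integrable function whose Fourier transform vanishes is zero almost everywhere. -/
theorem ae_eq_zero_of_fourier_eq_zero {g : ℝ → ℂ} (hg : Integrable g) (h : ∀ ξ, 𝓕 g ξ = 0) :
    g =ᵐ[volume] 0 := by
  refine ae_eq_zero_of_integral_contDiff_smul_eq_zero hg.locallyIntegrable ?_
  intro ψ hψ hs
  let Ψ : SchwartzMap ℝ ℂ := HasCompactSupport.toSchwartzMap (f := fun x => (ψ x : ℂ))
    (hs.comp_left (g := fun y : ℝ => (y : ℂ)) Complex.ofReal_zero)
    (Complex.ofRealCLM.contDiff.comp hψ)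
  let θ : SchwartzMap ℝ ℂ := 𝓕⁻ Ψ
  have key := VectorFourier.integral_fourierIntegral_smul_eq_flip (μ := volume) (ν := volume)
    (L := innerₗ ℝ) (f := ⇑θ) (g := g) Real.continuous_fourierChar continuous_inner
    θ.integrable hg
  rw [flip_innerₗ] at key
  have h1 : ∀ ξ, VectorFourier.fourierIntegral Real.fourierChar volume (innerₗ ℝ) (⇑θ) ξ
      = ψ ξ := by
    intro ξ
    have h2 : (𝓕 θ : SchwartzMap ℝ ℂ) = Ψ := FourierTransform.fourier_fourierInv_eq Ψ
    exact congrArg (fun φ : SchwartzMap ℝ ℂ => φ ξ) h2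
  have h3 : ∀ x, VectorFourier.fourierIntegral Real.fourierChar volume (innerₗ ℝ) g x = 0 := h
  simp only [h1, h3, smul_zero, integral_zero] at key
  simpa [Complex.real_smul] using key

/-- The functions `P(x) e^{-c x²}` are complete: expanding `e^{iξx}` in powers of `x`, an orthogonal
`f` has the property that the Fourier transform of `f(x) e^{-c x²}` vanishes. -/
theorem eq_zero_of_inner_gaussPoly_eq_zero {c : ℝ} (hc : 0 < c) {f : L2}
    (h : ∀ P, inner ℂ (gaussPoly hc P) f = 0) : f = 0 := by
  have hmom : ∀ n, ∫ x : ℝ, (x ^ n * Real.exp (-c * x ^ 2)) • f x = 0 := fun n => by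
    rw [← inner_gaussPoly_X_pow hc, h]
  let g : ℝ → ℂ := fun x => Real.exp (-c * x ^ 2) • f x
  have hgm : AEStronglyMeasurable g volume :=
    (contDiff_exp_neg_mul_sq c).continuous.aestronglyMeasurable.smul (Lp.aestronglyMeasurable f)
  have hexp : ∀ a : ℝ, Integrable fun x => Real.exp |a * x| * ‖g x‖ := by
    intro a
    have hm : MemLp (fun x : ℝ => Real.exp |a * x| * Real.exp (-c * x ^ 2)) 2 volume := by
      refine ((memLp_pow_mul_exp (c := c / 2) (by positivity) 0).const_mul
        (Real.exp (a ^ 2 / (2 * c)))).mono' (Continuous.aestronglyMeasurable (by fun_prop))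
        (Eventually.of_forall fun x => ?_)
      rw [Real.norm_of_nonneg (by positivity), pow_zero, one_mul, ← Real.exp_add, ← Real.exp_add,
        Real.exp_le_exp, div_add' _ _ _ (by positivity), le_div_iff₀ (by positivity), abs_mul,
        ← sq_abs a, ← sq_abs x]
      linarith [sq_nonneg (|a| - c * |x|)]
    refine (hm.integrable_mul (Lp.memLp f).norm).congr (Eventually.of_forall fun x => ?_)
    simp only [Pi.mul_apply, g, norm_smul, Real.norm_of_nonneg (Real.exp_pos _).le]
    ring
  have hg : Integrable g := by
    refine (integrable_norm_iff hgm).1 ?_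
    simpa using hexp 0
  have hchar : ∀ a : ℝ, ∫ x, Complex.exp ((a * x : ℝ) * Complex.I) * g x = 0 := by
    intro a
    have hs := hasSum_integral_of_dominated_convergence
      (F := fun (n : ℕ) (x : ℝ) => (((a * x : ℝ) : ℂ) * Complex.I) ^ n / (n.factorial : ℂ) * g x)
      (f := fun x => Complex.exp ((a * x : ℝ) * Complex.I) * g x)
      (μ := volume) (fun n x => |a * x| ^ n / n.factorial * ‖g x‖)
      (fun n => (Continuous.aestronglyMeasurable (by fun_prop)).mul hgm)
      (fun n => Eventually.of_forall fun x => by simp)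
      (Eventually.of_forall fun x =>
        (Real.summable_pow_div_factorial |a * x|).mul_right _)
      (by
        refine (hexp a).congr (Eventually.of_forall fun x => ?_)
        simp only [tsum_mul_right]
        rw [Real.exp_eq_exp_ℝ, NormedSpace.exp_eq_tsum_div])
      (Eventually.of_forall fun x => by
        refine HasSum.mul_right _ ?_
        rw [Complex.exp_eq_exp_ℂ]
        exact NormedSpace.expSeries_div_hasSum_exp _)
    refine hs.unique ?_
    have : ∀ n : ℕ, ∫ x, (((a * x : ℝ) : ℂ) * Complex.I) ^ n / (n.factorial : ℂ) * g x = 0 := by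
      intro n
      have h0 := congrArg (fun z => ((a : ℂ) * Complex.I) ^ n / (n.factorial : ℂ) * z) (hmom n)
      simp only [mul_zero, ← integral_const_mul] at h0
      rw [← h0]
      refine integral_congr_ae (Eventually.of_forall fun x => ?_)
      simp only [g, Complex.real_smul, Complex.ofReal_mul, Complex.ofReal_pow]
      ring
    simp only [this]
    exact hasSum_zero
  have h0 : g =ᵐ[volume] 0 := by
    refine ae_eq_zero_of_fourier_eq_zero hg fun ξ => ?_
    rw [Real.fourier_eq']
    rw [← hchar (-2 * Real.pi * ξ)]
    refine integral_congr_ae (Eventually.of_forall fun x => ?_)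
    simp only [smul_eq_mul]
    congr 4
    simp
    ring
  refine (Lp.eq_zero_iff_ae_eq_zero).2 ?_
  filter_upwards [h0] with x hx
  simpa [g, Real.exp_ne_zero] using hx

/-! ### Hermite polynomials -/

/-- Rescaled Hermite polynomials, normalized to be monic: the polynomial solutions of
`x p' - k p'' = n p`. -/
def hermPoly (k : ℂ) : ℕ → ℂ[X]
  | 0 => 1
  | n + 1 => X * hermPoly k n - C k * derivative (hermPoly k n)

theorem hermPoly_succ (k : ℂ) (n : ℕ) :
    hermPoly k (n + 1) = X * hermPoly k n - C k * derivative (hermPoly k n) := rfl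

theorem derivative_natCast_add_one_mul (n : ℕ) (P : ℂ[X]) :
    derivative ((n + 1 : ℂ[X]) * P) = (n + 1 : ℂ[X]) * derivative P := by
  rw [derivative_mul]
  simp

theorem derivative_hermPoly_succ (k : ℂ) (n : ℕ) :
    derivative (hermPoly k (n + 1)) = (n + 1 : ℂ[X]) * hermPoly k n := by
  induction n with
  | zero => simp [hermPoly]
  | succ n ih =>
    rw [hermPoly_succ k (n + 1), derivative_sub, derivative_mul, derivative_X, derivative_C_mul, ih]
    rw [derivative_natCast_add_one_mul]
    push_cast
    linear_combination (n + 1 : ℂ[X]) * (hermPoly_succ k n).symm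

/-- Hermite's differential equation. -/
theorem hermPoly_ode (k : ℂ) (n : ℕ) :
    X * derivative (hermPoly k n) - C k * derivative (derivative (hermPoly k n))
      = (n : ℂ[X]) * hermPoly k n := by
  cases n with
  | zero => simp [hermPoly]
  | succ n =>
    rw [derivative_hermPoly_succ, derivative_natCast_add_one_mul, hermPoly_succ]
    push_cast
    ring

theorem monic_hermPoly (k : ℂ) (n : ℕ) : (hermPoly k n).Monic ∧ (hermPoly k n).degree = n := by
  induction n with
  | zero => simp [hermPoly]
  | succ n ih =>
    have h1 : (X * hermPoly k n).degree = ((n + 1 : ℕ) : WithBot ℕ) := by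
      rw [X_mul, degree_mul_X, ih.2]
      rfl
    have h2 : (C k * derivative (hermPoly k n)).degree < (X * hermPoly k n).degree := by
      rw [h1, ← smul_eq_C_mul]
      refine (degree_smul_le _ _).trans_lt (((degree_derivative_le).trans_eq ih.2).trans_lt ?_)
      exact_mod_cast Nat.lt_succ_self n
    exact ⟨(monic_X.mul ih.1).sub_of_left h2, by
      rw [hermPoly_succ, degree_sub_eq_left_of_degree_lt h2, h1]⟩

theorem hermPoly_ne_zero (k : ℂ) (n : ℕ) : hermPoly k n ≠ 0 := (monic_hermPoly k n).1.ne_zero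

theorem span_hermPoly (k : ℂ) : Submodule.span ℂ (Set.range (hermPoly k)) = ⊤ := by
  let S : Polynomial.Sequence ℂ := ⟨hermPoly k, fun n => (monic_hermPoly k n).2⟩
  exact S.span fun i => by
    change IsUnit (hermPoly k i).leadingCoeff
    rw [(monic_hermPoly k i).1]
    exact isUnit_one

theorem eq_zero_of_inner_hermPoly_eq_zero {c : ℝ} (hc : 0 < c) (k : ℂ) {f : L2}
    (h : ∀ n, inner ℂ (gaussPoly hc (hermPoly k n)) f = 0) : f = 0 := by
  refine eq_zero_of_inner_gaussPoly_eq_zero hc fun P => ?_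
  have hP : P ∈ Submodule.span ℂ (Set.range (hermPoly k)) := by rw [span_hermPoly]; trivial
  induction hP using Submodule.span_induction with
  | mem x hx => obtain ⟨n, rfl⟩ := hx; exact h n
  | zero => simp
  | add x y _ _ hx hy => rw [map_add, inner_add_left, hx, hy, add_zero]
  | smul a x _ hx => rw [map_smul, inner_smul_left, hx, mul_zero]

/-! ### Closedness of differentiation and multiplication -/

theorem IsWeakDeriv.unique {f g g' : L2} (h : IsWeakDeriv f g) (h' : IsWeakDeriv f g') :
    g = g' := by
  have := weakDerivGraph_functional ((f, g) - (f, g')) (weakDerivGraph.sub_mem h h') (by simp)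
  simpa [sub_eq_zero] using this

theorem tendsto_integral_test_smul {φ : ℝ → ℝ} (hφ : Continuous φ) (hc : HasCompactSupport φ)
    {u : ℕ → L2} {f : L2} (hu : Tendsto u atTop (𝓝 f)) :
    Tendsto (fun n => ∫ x, φ x • u n x) atTop (𝓝 (∫ x, φ x • f x)) := by
  have hm : MemLp (fun x => (φ x : ℂ)) 2 volume :=
    (hφ.memLp_of_hasCompactSupport hc).ofReal
  have key : ∀ g : L2, ∫ x, φ x • g x = inner ℂ (hm.toLp _) g := by
    intro g
    rw [L2.inner_def]
    refine integral_congr_ae ?_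
    filter_upwards [hm.coeFn_toLp] with x hx
    rw [hx, RCLike.inner_apply, Complex.real_smul, Complex.conj_ofReal, mul_comm]
  simp only [key]
  exact tendsto_const_nhds.inner hu

/-- The weak derivative is a closed operator. -/
theorem isWeakDeriv_of_tendsto {u v : ℕ → L2} {f g : L2} (hu : Tendsto u atTop (𝓝 f))
    (hv : Tendsto v atTop (𝓝 g)) (h : ∀ n, IsWeakDeriv (u n) (v n)) : IsWeakDeriv f g := by
  intro φ hφ hc
  have h1 := tendsto_integral_test_smul (hφ.continuous_deriv (by simp)) hc.deriv hu
  have h2 := (tendsto_integral_test_smul hφ.continuous hc hv).neg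
  refine tendsto_nhds_unique h1 (h2.congr fun n => ?_)
  exact (h n φ hφ hc).symm

/-- Multiplication by a function is a closed operator. -/
theorem ae_eq_mul_of_tendsto {w : ℝ → ℂ} {u v : ℕ → L2} {f g : L2} (hu : Tendsto u atTop (𝓝 f))
    (hv : Tendsto v atTop (𝓝 g)) (h : ∀ n, v n =ᵐ[volume] fun x => w x * u n x) :
    g =ᵐ[volume] fun x => w x * f x := by
  obtain ⟨ns, hns, h1⟩ := (tendstoInMeasure_of_tendsto_Lp hu).exists_seq_tendsto_ae
  obtain ⟨ms, hms, h2⟩ :=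
    (tendstoInMeasure_of_tendsto_Lp (hv.comp hns.tendsto_atTop)).exists_seq_tendsto_ae
  filter_upwards [h1, h2, ae_all_iff.2 h] with x hx1 hx2 hx
  refine tendsto_nhds_unique hx2 ?_
  have := (hx1.comp hms.tendsto_atTop).const_mul (w x)
  refine this.congr fun n => ?_
  simp [hx]

/-! ### The operators on their domains -/

theorem exists_oscillator_apply {f : L2} (hf : f ∈ oscillator.domain) :
    ∃ f₁ f₂ q : L2, IsWeakDeriv f f₁ ∧ IsWeakDeriv f₁ f₂ ∧
      q =ᵐ[volume] (fun x : ℝ => ((x ^ 2 : ℝ) : ℂ) * f x) ∧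
      oscillator ⟨f, hf⟩ = (-(1 / 4) : ℂ) • f₂ + q := by
  obtain ⟨h1, h2⟩ := (mem_pcomp_domain_iff _ _ _).1 hf.1
  exact ⟨ddx ⟨f, h1⟩, ddx ⟨ddx ⟨f, h1⟩, h2⟩, _, isWeakDeriv_ddx ⟨f, h1⟩, isWeakDeriv_ddx ⟨_, h2⟩,
    MemLp.coeFn_toLp hf.2, rfl⟩

theorem ddx_eq {f g : L2} (h : IsWeakDeriv f g) (hf : f ∈ ddx.domain) : ddx ⟨f, hf⟩ = g :=
  (isWeakDeriv_ddx ⟨f, hf⟩).unique h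

theorem oscillator_eq {f f₁ f₂ q : L2} (h1 : IsWeakDeriv f f₁) (h2 : IsWeakDeriv f₁ f₂)
    (hq : q =ᵐ[volume] fun x : ℝ => ((x ^ 2 : ℝ) : ℂ) * f x) :
    ∃ hf : f ∈ oscillator.domain, oscillator ⟨f, hf⟩ = (-(1 / 4) : ℂ) • f₂ + q := by
  have hf : f ∈ oscillator.domain := by
    have : f ∈ domD := ⟨⟨f₁, f₂, h1, h2⟩, (Lp.memLp q).ae_eq hq⟩
    rw [← oscillator_domain] at this
    exact this
  refine ⟨hf, ?_⟩
  obtain ⟨g₁, g₂, p, hg1, hg2, hp, h⟩ := exists_oscillator_apply hf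
  obtain rfl := hg1.unique h1
  obtain rfl := hg2.unique h2
  obtain rfl : p = q := Lp.ext (hp.trans hq.symm)
  exact h

theorem exists_pert_apply (γ : ℝ) {f : L2} (hf : f ∈ (pert γ).domain) :
    ∃ f₁ r : L2, IsWeakDeriv f f₁ ∧ r =ᵐ[volume] (fun x : ℝ => (x : ℂ) * f₁ x) ∧
      pert γ ⟨f, hf⟩ = (-γ : ℂ) • ((1 / 2 : ℂ) • f + r) := by
  obtain ⟨h1, h2⟩ := (mem_pcomp_domain_iff _ _ _).1 hf.2
  exact ⟨ddx ⟨f, h1⟩, _, isWeakDeriv_ddx ⟨f, h1⟩, MemLp.coeFn_toLp h2, rfl⟩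

theorem pert_eq (γ : ℝ) {f f₁ r : L2} (h1 : IsWeakDeriv f f₁)
    (hr : r =ᵐ[volume] fun x : ℝ => (x : ℂ) * f₁ x) :
    ∃ hf : f ∈ (pert γ).domain, pert γ ⟨f, hf⟩ = (-γ : ℂ) • ((1 / 2 : ℂ) • f + r) := by
  have hd : f ∈ ddx.domain := (mem_ddx_domain_iff f).2 ⟨f₁, h1⟩
  have hf : f ∈ (pert γ).domain := by
    refine ⟨trivial, (mem_pcomp_domain_iff _ _ _).2 ⟨hd, ?_⟩⟩
    rw [ddx_eq h1 hd]
    exact (Lp.memLp r).ae_eq hr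
  refine ⟨hf, ?_⟩
  obtain ⟨g₁, p, hg1, hp, h⟩ := exists_pert_apply γ hf
  obtain rfl := hg1.unique h1
  obtain rfl : p = r := Lp.ext (hp.trans hr.symm)
  exact h

theorem inner_gaussPoly_mul_x_sq {f g : L2}
    (h : g =ᵐ[volume] fun x : ℝ => ((x ^ 2 : ℝ) : ℂ) * f x) {c : ℝ} (hc : 0 < c) (P : ℂ[X]) :
    inner ℂ (gaussPoly hc P) g = inner ℂ (gaussPoly hc (X * (X * P))) f := by
  rw [L2.inner_def, L2.inner_def]
  refine integral_congr_ae ?_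
  filter_upwards [coeFn_gaussPoly hc P, coeFn_gaussPoly hc (X * (X * P)), h] with x h1 h2 h3
  rw [h1, h2, h3, RCLike.inner_apply, RCLike.inner_apply]
  simp
  ring

/-! ### The operators on Gaussians times polynomials -/

/-- The action of the harmonic oscillator on the polynomial factor of `P(x) e^{-c x²}`. -/
def oscPoly (c : ℝ) : ℂ[X] →ₗ[ℂ] ℂ[X] :=
  (-(1 / 4) : ℂ) • gaussDeriv c ∘ₗ gaussDeriv c + LinearMap.mulLeft ℂ X ∘ₗ LinearMap.mulLeft ℂ X

/-- The action of `-γ (1/2 + x d/dx)` on the polynomial factor of `P(x) e^{-c x²}`. -/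
def pertPoly (c γ : ℝ) : ℂ[X] →ₗ[ℂ] ℂ[X] :=
  (-γ : ℂ) • ((1 / 2 : ℂ) • LinearMap.id + LinearMap.mulLeft ℂ X ∘ₗ gaussDeriv c)

theorem oscPoly_apply (c : ℝ) (P : ℂ[X]) :
    oscPoly c P = (-(1 / 4) : ℂ) • gaussDeriv c (gaussDeriv c P) + X * (X * P) := rfl

theorem pertPoly_apply (c γ : ℝ) (P : ℂ[X]) :
    pertPoly c γ P = (-γ : ℂ) • ((1 / 2 : ℂ) • P + X * gaussDeriv c P) := rfl

theorem gaussPoly_X_mul_X_mul {c : ℝ} (hc : 0 < c) (P : ℂ[X]) :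
    gaussPoly hc (X * (X * P)) =ᵐ[volume] fun x : ℝ => ((x ^ 2 : ℝ) : ℂ) * gaussPoly hc P x := by
  filter_upwards [coeFn_gaussPoly hc P, coeFn_gaussPoly hc (X * (X * P))] with x h1 h2
  rw [h1, h2]
  simp
  ring

theorem oscillator_gaussPoly {c : ℝ} (hc : 0 < c) (P : ℂ[X]) :
    ∃ h : gaussPoly hc P ∈ oscillator.domain,
      oscillator ⟨gaussPoly hc P, h⟩ = gaussPoly hc (oscPoly c P) := by
  obtain ⟨h, e⟩ := oscillator_eq (isWeakDeriv_gaussPoly hc P) (isWeakDeriv_gaussPoly hc _)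
    (gaussPoly_X_mul_X_mul hc P)
  exact ⟨h, by rw [e, oscPoly_apply, map_add, map_smul]⟩

/-- The harmonic oscillator is symmetric against Gaussians times polynomials. -/
theorem inner_gaussPoly_oscillator {c : ℝ} (hc : 0 < c) (P : ℂ[X]) {f : L2}
    (hf : f ∈ oscillator.domain) :
    inner ℂ (gaussPoly hc P) (oscillator ⟨f, hf⟩) = inner ℂ (gaussPoly hc (oscPoly c P)) f := by
  obtain ⟨f₁, f₂, q, h1, h2, hq, e⟩ := exists_oscillator_apply hf
  rw [e, oscPoly_apply, map_add, map_smul, inner_add_right, inner_add_left, inner_smul_right,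
    inner_smul_left, h2.inner_gaussPoly hc, h1.inner_gaussPoly hc, inner_gaussPoly_mul_x_sq hq]
  simp [map_ofNat (starRingEnd ℂ)]

/-- The formal adjoint of `-γ (1/2 + x d/dx)` is `γ (1/2 + x d/dx)`. -/
theorem inner_gaussPoly_pert {c : ℝ} (hc : 0 < c) (γ : ℝ) (P : ℂ[X]) {f : L2}
    (hf : f ∈ (pert γ).domain) :
    inner ℂ (gaussPoly hc P) (pert γ ⟨f, hf⟩) = inner ℂ (gaussPoly hc (pertPoly c (-γ) P)) f := by
  obtain ⟨f₁, r, h1, hr, e⟩ := exists_pert_apply γ hf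
  rw [e, pertPoly_apply, map_smul, map_add, map_smul, inner_smul_right, inner_smul_left,
    inner_add_right, inner_add_left, inner_smul_right,
    inner_smul_left, inner_gaussPoly_mul_x hr, h1.inner_gaussPoly hc, gaussDeriv_X_mul, map_add,
    inner_add_left]
  simp [map_ofNat (starRingEnd ℂ)]
  ring

/-! ### A priori estimates -/

section Estimates

theorem re_inner_self (f : L2) : (inner ℂ f f).re = ‖f‖ ^ 2 := inner_self_eq_norm_sq (𝕜 := ℂ) f

variable {c : ℝ} (hc : 0 < c) (P : ℂ[X])

theorem re_inner_gaussDeriv_X_mul :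
    (inner ℂ (gaussPoly hc (gaussDeriv c P)) (gaussPoly hc (X * P))).re
      = -(1 / 2) * ‖gaussPoly hc P‖ ^ 2 := by
  have h1 := inner_gaussPoly_gaussDeriv hc P (X * P)
  rw [gaussDeriv_X_mul, map_add, inner_add_right, inner_gaussPoly_X_mul] at h1
  have h2 := congrArg Complex.re h1
  have h3 := inner_re_symm (𝕜 := ℂ) (gaussPoly hc (X * P)) (gaussPoly hc (gaussDeriv c P))
  simp only [Complex.add_re, Complex.neg_re, RCLike.re_to_complex, re_inner_self] at h2 h3
  linarith

theorem re_inner_gaussDeriv_sq_X_sq_mul :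
    (inner ℂ (gaussPoly hc (gaussDeriv c (gaussDeriv c P))) (gaussPoly hc (X * (X * P)))).re
      = -‖gaussPoly hc (X * gaussDeriv c P)‖ ^ 2 + ‖gaussPoly hc P‖ ^ 2 := by
  have h1 := inner_gaussPoly_gaussDeriv hc (gaussDeriv c P) (X * (X * P))
  rw [gaussDeriv_X_mul, gaussDeriv_X_mul, mul_add, map_add, map_add, inner_add_right,
    inner_add_right, inner_gaussPoly_X_mul hc _ (X * gaussDeriv c P)] at h1
  have h2 := congrArg Complex.re h1
  have h3 := re_inner_gaussDeriv_X_mul hc P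
  simp only [Complex.add_re, Complex.neg_re, re_inner_self] at h2
  linarith

theorem norm_sq_smul_gaussDeriv_sq_add (t : ℝ) :
    ‖(t : ℂ) • gaussPoly hc (gaussDeriv c (gaussDeriv c P)) + gaussPoly hc (X * (X * P))‖ ^ 2
      = t ^ 2 * ‖gaussPoly hc (gaussDeriv c (gaussDeriv c P))‖ ^ 2
        + ‖gaussPoly hc (X * (X * P))‖ ^ 2
        + 2 * t * (‖gaussPoly hc P‖ ^ 2 - ‖gaussPoly hc (X * gaussDeriv c P)‖ ^ 2) := by
  rw [norm_add_sq (𝕜 := ℂ), norm_smul, inner_smul_left, mul_pow, Complex.conj_ofReal,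
    RCLike.re_to_complex, Complex.re_ofReal_mul, re_inner_gaussDeriv_sq_X_sq_mul,
    Complex.norm_real, Real.norm_eq_abs, sq_abs]
  ring

theorem norm_sq_oscPoly :
    ‖gaussPoly hc (oscPoly c P)‖ ^ 2
      = (1 / 16) * ‖gaussPoly hc (gaussDeriv c (gaussDeriv c P))‖ ^ 2
        + ‖gaussPoly hc (X * (X * P))‖ ^ 2 + (1 / 2) * ‖gaussPoly hc (X * gaussDeriv c P)‖ ^ 2
        - (1 / 2) * ‖gaussPoly hc P‖ ^ 2 := by
  have h := norm_sq_smul_gaussDeriv_sq_add hc P (-(1 / 4))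
  push_cast at h
  rw [oscPoly_apply, map_add, map_smul, h]
  ring

/-- The quantum counterpart of `x² ξ² ≤ (ξ²/4 + x²)²`, which holds since the difference is
`(ξ²/4 - x²)²`: the commutators only contribute a multiple of `‖P‖²`. -/
theorem norm_sq_X_mul_gaussDeriv_le :
    ‖gaussPoly hc (X * gaussDeriv c P)‖ ^ 2
      ≤ ‖gaussPoly hc (oscPoly c P)‖ ^ 2 + ‖gaussPoly hc P‖ ^ 2 := by
  have h1 := norm_sq_smul_gaussDeriv_sq_add hc P (1 / 4)
  have h2 := norm_sq_oscPoly hc P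
  have h3 := sq_nonneg ‖((1 / 4 : ℝ) : ℂ) • gaussPoly hc (gaussDeriv c (gaussDeriv c P))
    + gaussPoly hc (X * (X * P))‖
  linarith

theorem norm_sq_X_sq_mul_le :
    ‖gaussPoly hc (X * (X * P))‖ ^ 2
      ≤ 16 * (‖gaussPoly hc (oscPoly c P)‖ ^ 2 + ‖gaussPoly hc P‖ ^ 2) := by
  have h2 := norm_sq_oscPoly hc P
  have := sq_nonneg ‖gaussPoly hc (gaussDeriv c (gaussDeriv c P))‖
  have := sq_nonneg ‖gaussPoly hc (X * gaussDeriv c P)‖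
  have := sq_nonneg ‖gaussPoly hc P‖
  have := sq_nonneg ‖gaussPoly hc (oscPoly c P)‖
  linarith

theorem norm_sq_gaussDeriv_sq_le :
    ‖gaussPoly hc (gaussDeriv c (gaussDeriv c P))‖ ^ 2
      ≤ 16 * (‖gaussPoly hc (oscPoly c P)‖ ^ 2 + ‖gaussPoly hc P‖ ^ 2) := by
  have h2 := norm_sq_oscPoly hc P
  have := sq_nonneg ‖gaussPoly hc (X * (X * P))‖
  have := sq_nonneg ‖gaussPoly hc (X * gaussDeriv c P)‖
  have := sq_nonneg ‖gaussPoly hc P‖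
  linarith

theorem norm_sq_gaussDeriv_le :
    ‖gaussPoly hc (gaussDeriv c P)‖ ^ 2
      ≤ 16 * (‖gaussPoly hc (oscPoly c P)‖ ^ 2 + ‖gaussPoly hc P‖ ^ 2) := by
  have h1 := inner_gaussPoly_gaussDeriv hc P (gaussDeriv c P)
  have h2 : ‖gaussPoly hc (gaussDeriv c P)‖ ^ 2
      ≤ ‖gaussPoly hc P‖ * ‖gaussPoly hc (gaussDeriv c (gaussDeriv c P))‖ := by
    refine le_trans (le_of_eq ?_) (norm_inner_le_norm (𝕜 := ℂ) _ _)
    rw [h1, norm_neg, inner_self_eq_norm_sq_to_K, norm_pow]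
    simp
  have h3 := norm_sq_gaussDeriv_sq_le hc P
  have := sq_nonneg (‖gaussPoly hc P‖ - ‖gaussPoly hc (gaussDeriv c (gaussDeriv c P))‖)
  have := sq_nonneg ‖gaussPoly hc P‖
  have := sq_nonneg ‖gaussPoly hc (oscPoly c P)‖
  nlinarith

theorem norm_sq_pertPoly_le (γ : ℝ) :
    ‖gaussPoly hc (pertPoly c γ P)‖ ^ 2
      ≤ γ ^ 2 * (‖gaussPoly hc (oscPoly c P)‖ ^ 2 + ‖gaussPoly hc P‖ ^ 2) := by
  rw [pertPoly_apply, map_smul, map_add, map_smul, norm_smul, mul_pow, norm_neg, Complex.norm_real,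
    Real.norm_eq_abs, sq_abs]
  refine mul_le_mul_of_nonneg_left ?_ (sq_nonneg γ)
  have h1 := norm_sq_X_mul_gaussDeriv_le hc P
  have h2 := re_inner_gaussDeriv_X_mul hc P
  have h3 := inner_re_symm (𝕜 := ℂ) (gaussPoly hc (X * P)) (gaussPoly hc (gaussDeriv c P))
  simp only [RCLike.re_to_complex] at h3
  rw [norm_add_sq (𝕜 := ℂ), inner_smul_left, inner_gaussPoly_X_mul, norm_smul, mul_pow,
    RCLike.re_to_complex]
  have h4 : (starRingEnd ℂ) (1 / 2) = ((1 / 2 : ℝ) : ℂ) := by simp [map_ofNat (starRingEnd ℂ)]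
  rw [h4, Complex.re_ofReal_mul, h3, h2]
  have := sq_nonneg ‖gaussPoly hc P‖
  norm_num
  linarith

theorem re_inner_oscPoly_nonneg :
    0 ≤ (inner ℂ (gaussPoly hc (oscPoly c P)) (gaussPoly hc P)).re := by
  rw [oscPoly_apply, map_add, map_smul, inner_add_left, inner_smul_left,
    ← neg_eq_iff_eq_neg.2 (inner_gaussPoly_gaussDeriv hc (gaussDeriv c P) P),
    ← inner_gaussPoly_X_mul]
  have h4 : (starRingEnd ℂ) (-(1 / 4)) = ((-(1 / 4) : ℝ) : ℂ) := by
    simp [map_ofNat (starRingEnd ℂ)]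
  rw [h4, Complex.add_re, Complex.re_ofReal_mul, Complex.neg_re]
  have h1 := inner_self_nonneg (𝕜 := ℂ) (x := gaussPoly hc (gaussDeriv c P))
  have h2 := inner_self_nonneg (𝕜 := ℂ) (x := gaussPoly hc (X * P))
  simp only [RCLike.re_to_complex] at h1 h2
  linarith

theorem norm_sq_oscPoly_add_le :
    ‖gaussPoly hc (oscPoly c P)‖ ^ 2 + ‖gaussPoly hc P‖ ^ 2
      ≤ ‖gaussPoly hc (oscPoly c P) + gaussPoly hc P‖ ^ 2 := by
  have := re_inner_oscPoly_nonneg hc P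
  rw [norm_add_sq (𝕜 := ℂ), RCLike.re_to_complex]
  linarith

end Estimates

/-! ### Limits in the graph norm of the oscillator -/

theorem exists_tendsto_of_norm_sq_le {c : ℝ} (hc : 0 < c) {S : ℂ[X] →ₗ[ℂ] ℂ[X]}
    (hS : ∀ P, ‖gaussPoly hc (S P)‖ ^ 2
      ≤ 16 * (‖gaussPoly hc (oscPoly c P)‖ ^ 2 + ‖gaussPoly hc P‖ ^ 2))
    {P : ℕ → ℂ[X]} {f u : L2} (h1 : Tendsto (fun n => gaussPoly hc (P n)) atTop (𝓝 f))
    (h2 : Tendsto (fun n => gaussPoly hc (oscPoly c (P n))) atTop (𝓝 u)) :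
    ∃ g, Tendsto (fun n => gaussPoly hc (S (P n))) atTop (𝓝 g) := by
  refine cauchySeq_tendsto_of_complete ?_
  rw [cauchySeq_iff_tendsto_dist_atTop_0]
  have h3 := ((cauchySeq_iff_tendsto_dist_atTop_0.1 h2.cauchySeq).add
    (cauchySeq_iff_tendsto_dist_atTop_0.1 h1.cauchySeq)).const_mul 4
  rw [add_zero, mul_zero] at h3
  refine squeeze_zero (fun _ => dist_nonneg) (fun p => ?_) h3
  simp only [dist_eq_norm, ← map_sub]
  refine abs_le_of_sq_le_sq' ?_ (by positivity) |>.2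
  refine (hS _).trans ?_
  have := norm_nonneg (gaussPoly hc (P p.1 - P p.2))
  have := norm_nonneg (gaussPoly hc (oscPoly c (P p.1 - P p.2)))
  nlinarith

/-- Limits of Gaussians times polynomials in the graph norm of the oscillator lie in the domain
of the oscillator and of the perturbation: by the a priori estimates every single term converges. -/
theorem oscillator_of_tendsto {c : ℝ} (hc : 0 < c) {P : ℕ → ℂ[X]} {f u : L2}
    (h1 : Tendsto (fun n => gaussPoly hc (P n)) atTop (𝓝 f))
    (h2 : Tendsto (fun n => gaussPoly hc (oscPoly c (P n))) atTop (𝓝 u)) :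
    ∃ h : f ∈ oscillator.domain, oscillator ⟨f, h⟩ = u ∧ ∀ γ, ∃ h' : f ∈ (pert γ).domain,
      Tendsto (fun n => gaussPoly hc (pertPoly c γ (P n))) atTop (𝓝 (pert γ ⟨f, h'⟩)) := by
  obtain ⟨f₁, hf₁⟩ := exists_tendsto_of_norm_sq_le hc (S := gaussDeriv c)
    (norm_sq_gaussDeriv_le hc) h1 h2
  obtain ⟨f₂, hf₂⟩ := exists_tendsto_of_norm_sq_le hc (S := gaussDeriv c ∘ₗ gaussDeriv c)
    (norm_sq_gaussDeriv_sq_le hc) h1 h2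
  obtain ⟨q, hq⟩ := exists_tendsto_of_norm_sq_le hc
    (S := LinearMap.mulLeft ℂ X ∘ₗ LinearMap.mulLeft ℂ X) (norm_sq_X_sq_mul_le hc) h1 h2
  obtain ⟨r, hr⟩ := exists_tendsto_of_norm_sq_le hc (S := LinearMap.mulLeft ℂ X ∘ₗ gaussDeriv c)
    (fun P => (norm_sq_X_mul_gaussDeriv_le hc P).trans
      (le_mul_of_one_le_left (by positivity) (by norm_num))) h1 h2
  simp only [LinearMap.comp_apply, LinearMap.mulLeft_apply] at hf₂ hq hr
  have d1 : IsWeakDeriv f f₁ := isWeakDeriv_of_tendsto h1 hf₁ fun _ => isWeakDeriv_gaussPoly hc _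
  have d2 : IsWeakDeriv f₁ f₂ := isWeakDeriv_of_tendsto hf₁ hf₂ fun _ => isWeakDeriv_gaussPoly hc _
  have m1 := ae_eq_mul_of_tendsto h1 hq fun _ => gaussPoly_X_mul_X_mul hc _
  have m2 := ae_eq_mul_of_tendsto hf₁ hr fun _ => gaussPoly_X_mul hc _
  obtain ⟨h, e⟩ := oscillator_eq d1 d2 m1
  refine ⟨h, ?_, fun γ => ?_⟩
  · rw [e]
    refine tendsto_nhds_unique ?_ h2
    simp only [oscPoly_apply, map_add, map_smul]
    exact (hf₂.const_smul _).add hq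
  · obtain ⟨h', e'⟩ := pert_eq γ d1 m2
    refine ⟨h', ?_⟩
    rw [e']
    simp only [pertPoly_apply, map_smul, map_add]
    exact ((h1.const_smul _).add hr).const_smul _

/-! ### Hermite functions -/

/-- Conjugation by `e^{-γ x²}` turns `H` into the oscillator `-(1/4) d²/dx² + ω² x²` with
`ω² = 1 + γ²`. Hence Hermite polynomials times `e^{-(ω + γ) x²}` are eigenfunctions of `H`. -/
theorem oscPoly_add_pertPoly_hermPoly {γ w : ℝ} (hw : 0 < w) (h : w ^ 2 = 1 + γ ^ 2) (n : ℕ) :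
    oscPoly (w + γ) (hermPoly (1 / (4 * w)) n) + pertPoly (w + γ) γ (hermPoly (1 / (4 * w)) n)
      = (w * (n + 1 / 2) : ℂ) • hermPoly (1 / (4 * w)) n := by
  refine Polynomial.funext fun z => ?_
  have ode := congrArg (Polynomial.eval z) (hermPoly_ode (1 / (4 * w)) n)
  have hw' : (w : ℂ) ≠ 0 := by exact_mod_cast hw.ne'
  have h' : (w : ℂ) ^ 2 = 1 + (γ : ℂ) ^ 2 := by exact_mod_cast h
  simp only [eval_sub, eval_mul, eval_X, eval_C, eval_natCast] at ode
  simp only [oscPoly_apply, pertPoly_apply, gaussDeriv_apply, derivative_sub, derivative_mul,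
    derivative_C, derivative_X, eval_add, eval_smul, eval_sub, eval_mul, eval_X, eval_C,
    smul_eq_mul, zero_mul, zero_add, mul_one]
  push_cast
  have h2 : (w : ℂ) * (1 / (4 * w)) = 1 / 4 := by field_simp
  linear_combination (w : ℂ) * ode - z ^ 2 * eval z (hermPoly (1 / (4 * w)) n) * h'
    + eval z (derivative (derivative (hermPoly (1 / (4 * w)) n))) * h2

/-- The unnormalized Hermite functions, eigenfunctions of the oscillator. -/
theorem oscPoly_hermPoly (n : ℕ) :
    oscPoly 1 (hermPoly (1 / 4) n) = ((n : ℂ) + 1 / 2) • hermPoly (1 / 4) n := by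
  have h := oscPoly_add_pertPoly_hermPoly (γ := 0) one_pos (by norm_num) n
  simpa [pertPoly_apply] using h

/-- The polynomial factors of the normalized Hermite functions. -/
def hermNormal (n : ℕ) : ℂ[X] :=
  ((‖gaussPoly one_pos (hermPoly (1 / 4) n)‖⁻¹ : ℝ) : ℂ) • hermPoly (1 / 4) n

theorem oscPoly_hermNormal (n : ℕ) :
    oscPoly 1 (hermNormal n) = ((n : ℂ) + 1 / 2) • hermNormal n := by
  rw [hermNormal, map_smul, oscPoly_hermPoly, smul_comm]

/-- The normalized Hermite functions. -/
def hermFun (n : ℕ) : L2 := gaussPoly one_pos (hermNormal n)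

theorem hermFun_eq (n : ℕ) : hermFun n = gaussPoly one_pos (hermNormal n) := rfl

/-- Eigenfunctions of a symmetric operator for distinct eigenvalues are orthogonal. -/
theorem orthonormal_hermFun : Orthonormal ℂ hermFun := by
  constructor
  · intro n
    have h : gaussPoly one_pos (hermPoly (1 / 4) n) ≠ 0 :=
      (map_ne_zero_iff _ (gaussPoly_injective one_pos)).2 (hermPoly_ne_zero _ n)
    rw [hermFun_eq, hermNormal, map_smul, norm_smul, Complex.norm_real, norm_inv, norm_norm,
      inv_mul_cancel₀ (norm_ne_zero_iff.2 h)]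
  · intro m n hmn
    obtain ⟨h, e⟩ := oscillator_gaussPoly one_pos (hermNormal n)
    have key := inner_gaussPoly_oscillator one_pos (hermNormal m) h
    rw [e, oscPoly_hermNormal, oscPoly_hermNormal, map_smul, map_smul, inner_smul_left,
      inner_smul_right] at key
    simp only [map_add, map_natCast, map_div₀, map_one, map_ofNat] at key
    have h3 : ((n : ℂ) - m) * inner ℂ (hermFun m) (hermFun n) = 0 := by
      rw [hermFun_eq, hermFun_eq]
      linear_combination key
    exact (mul_eq_zero.1 h3).resolve_left (sub_ne_zero.2 (by exact_mod_cast hmn.symm))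

theorem orthogonal_span_hermFun : (Submodule.span ℂ (Set.range hermFun))ᗮ = ⊥ := by
  rw [Submodule.eq_bot_iff]
  intro f hf
  rw [Submodule.mem_orthogonal] at hf
  refine eq_zero_of_inner_hermPoly_eq_zero one_pos (1 / 4) fun n => ?_
  have h := hf _ (Submodule.subset_span ⟨n, rfl⟩)
  have h0 : gaussPoly one_pos (hermPoly (1 / 4) n) ≠ 0 :=
    (map_ne_zero_iff _ (gaussPoly_injective one_pos)).2 (hermPoly_ne_zero _ n)
  rw [hermFun_eq, hermNormal, map_smul, inner_smul_left] at h
  exact (mul_eq_zero.1 h).resolve_left (by simpa using h0)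

/-- The Hilbert basis of Hermite functions. -/
def hermBasis : HilbertBasis ℕ ℂ L2 :=
  HilbertBasis.mkOfOrthogonalEqBot orthonormal_hermFun orthogonal_span_hermFun

theorem tendsto_sum_hermFun (f : L2) :
    Tendsto (fun N => ∑ n ∈ Finset.range N, inner ℂ (hermFun n) f • hermFun n) atTop (𝓝 f) := by
  have h := (hermBasis.hasSum_repr f).tendsto_sum_nat
  simp only [HilbertBasis.repr_apply_apply] at h
  simpa [hermBasis, HilbertBasis.coe_mkOfOrthogonalEqBot] using h

theorem gaussPoly_sum_hermNormal (a : ℕ → ℂ) (N : ℕ) :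
    gaussPoly one_pos (∑ n ∈ Finset.range N, a n • hermNormal n)
      = ∑ n ∈ Finset.range N, a n • hermFun n := by
  simp only [map_sum, map_smul, hermFun_eq]

theorem gaussPoly_oscPoly_sum_hermNormal (a : ℕ → ℂ) (N : ℕ) :
    gaussPoly one_pos (oscPoly 1 (∑ n ∈ Finset.range N, a n • hermNormal n))
      = ∑ n ∈ Finset.range N, (a n * (n + 1 / 2)) • hermFun n := by
  simp only [map_sum, map_smul, hermFun_eq, oscPoly_hermNormal, mul_smul]

/-! ### The Hermite expansion in the domain of the oscillator -/

/-- The Gaussians times polynomials form a core of the oscillator: partial sums of the Hermite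
expansion converge in the graph norm. -/
theorem exists_tendsto_gaussPoly {f : L2} (hf : f ∈ oscillator.domain) :
    ∃ P : ℕ → ℂ[X], Tendsto (fun n => gaussPoly one_pos (P n)) atTop (𝓝 f) ∧
      Tendsto (fun n => gaussPoly one_pos (oscPoly 1 (P n))) atTop (𝓝 (oscillator ⟨f, hf⟩)) := by
  refine ⟨fun N => ∑ n ∈ Finset.range N, inner ℂ (hermFun n) f • hermNormal n, ?_, ?_⟩
  · simp only [gaussPoly_sum_hermNormal]
    exact tendsto_sum_hermFun f
  · simp only [gaussPoly_oscPoly_sum_hermNormal]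
    have h := tendsto_sum_hermFun (oscillator ⟨f, hf⟩)
    have e : ∀ n, inner ℂ (hermFun n) (oscillator ⟨f, hf⟩)
        = inner ℂ (hermFun n) f * ((n : ℂ) + 1 / 2) := by
      intro n
      rw [hermFun_eq, inner_gaussPoly_oscillator, oscPoly_hermNormal, map_smul, inner_smul_left,
        mul_comm]
      simp only [map_add, map_natCast, map_div₀, map_one, map_ofNat]
    simpa only [e] using h

theorem oscillator_domain_le_pert (γ : ℝ) : oscillator.domain ≤ (pert γ).domain := by
  intro f hf
  obtain ⟨P, h1, h2⟩ := exists_tendsto_gaussPoly hf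
  obtain ⟨-, -, h⟩ := oscillator_of_tendsto one_pos h1 h2
  exact (h γ).1

theorem norm_sq_pert_le (γ : ℝ) {f : L2} (hf : f ∈ oscillator.domain)
    (hf' : f ∈ (pert γ).domain) :
    ‖pert γ ⟨f, hf'⟩‖ ^ 2 ≤ γ ^ 2 * (‖oscillator ⟨f, hf⟩‖ ^ 2 + ‖f‖ ^ 2) := by
  obtain ⟨P, h1, h2⟩ := exists_tendsto_gaussPoly hf
  obtain ⟨-, -, h⟩ := oscillator_of_tendsto one_pos h1 h2
  obtain ⟨_, h3⟩ := h γ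
  exact le_of_tendsto_of_tendsto' (h3.norm.pow 2)
    (((h2.norm.pow 2).add (h1.norm.pow 2)).const_mul (γ ^ 2))
    fun n => norm_sq_pertPoly_le one_pos (P n) γ

theorem norm_sq_oscillator_add_le {f : L2} (hf : f ∈ oscillator.domain) :
    ‖oscillator ⟨f, hf⟩‖ ^ 2 + ‖f‖ ^ 2 ≤ ‖oscillator ⟨f, hf⟩ + f‖ ^ 2 := by
  obtain ⟨P, h1, h2⟩ := exists_tendsto_gaussPoly hf
  exact le_of_tendsto_of_tendsto' ((h2.norm.pow 2).add (h1.norm.pow 2)) ((h2.add h1).norm.pow 2)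
    fun n => norm_sq_oscPoly_add_le one_pos (P n)

/-! ### The resolvent of the oscillator -/

/-- A diagonal operator whose entries tend to zero is compact, as a norm limit of finite rank
operators. -/
theorem exists_isCompactOperator_diagonal {E : Type*} [NormedAddCommGroup E]
    [InnerProductSpace ℂ E] [CompleteSpace E] {e : ℕ → E} (he : Orthonormal ℂ e) {a : ℕ → ℂ}
    (ha : Tendsto a atTop (𝓝 0)) :
    ∃ T : E →L[ℂ] E, IsCompactOperator T ∧ ∀ u, Tendsto
      (fun N => ∑ n ∈ Finset.range N, (a n * inner ℂ (e n) u) • e n) atTop (𝓝 (T u)) := by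
  let S : ℕ → E →L[ℂ] E := fun N =>
    ∑ n ∈ Finset.range N, a n • (ContinuousLinearMap.toSpanSingleton ℂ (e n)) ∘L (innerSL ℂ (e n))
  have hS : ∀ N u, S N u = ∑ n ∈ Finset.range N, (a n * inner ℂ (e n) u) • e n := by
    intro N u
    simp [S, smul_smul]
  have hcomp : ∀ N, IsCompactOperator (S N) := by
    intro N
    induction N with
    | zero => simpa [S] using isCompactOperator_zero
    | succ N ih =>
      have h1 : IsCompactOperator
          ((ContinuousLinearMap.toSpanSingleton ℂ (e N)) ∘L (innerSL ℂ (e N)) : E →L[ℂ] E) :=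
        (isCompactOperator_of_locallyCompactSpace_dom (innerSL ℂ (e N))).clm_comp
          (ContinuousLinearMap.toSpanSingleton ℂ (e N))
      have h2 : S (N + 1) = S N
          + a N • (ContinuousLinearMap.toSpanSingleton ℂ (e N)) ∘L (innerSL ℂ (e N)) :=
        Finset.sum_range_succ _ _
      rw [h2]
      exact ih.add (h1.smul (a N))
  have hC : CauchySeq S := by
    refine Metric.cauchySeq_iff'.2 fun ε hε => ?_
    obtain ⟨N, hN⟩ := (Metric.tendsto_atTop.1 ha) (ε / 2) (by positivity)
    refine ⟨N, fun M hM => ?_⟩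
    rw [dist_eq_norm]
    refine lt_of_le_of_lt (ContinuousLinearMap.opNorm_le_bound _ (by positivity) fun u => ?_)
      (half_lt_self hε)
    rw [sub_apply, hS, hS, ← Finset.sum_Ico_eq_sub _ hM]
    refine abs_le_of_sq_le_sq' ?_ (by positivity) |>.2
    have h3 := he.inner_sum (fun n => a n * inner ℂ (e n) u) (fun n => a n * inner ℂ (e n) u)
      (Finset.Ico N M)
    rw [inner_self_eq_norm_sq_to_K] at h3
    have h4 : ‖∑ n ∈ Finset.Ico N M, (a n * inner ℂ (e n) u) • e n‖ ^ 2
        = ∑ n ∈ Finset.Ico N M, ‖a n * inner ℂ (e n) u‖ ^ 2 := by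
      have h5 : ∀ z : ℂ, (starRingEnd ℂ) z * z = ((‖z‖ ^ 2 : ℝ) : ℂ) := fun z => by
        rw [mul_comm, Complex.mul_conj, Complex.normSq_eq_norm_sq]
      simp only [h5] at h3
      rw [← Complex.ofReal_sum] at h3
      refine Complex.ofReal_injective (Eq.trans ?_ h3)
      exact Complex.ofReal_pow _ _
    rw [h4, mul_pow]
    calc _ ≤ ∑ n ∈ Finset.Ico N M, (ε / 2) ^ 2 * ‖inner ℂ (e n) u‖ ^ 2 := by
          refine Finset.sum_le_sum fun n hn => ?_
          rw [norm_mul, mul_pow]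
          have := hN n (Finset.mem_Ico.1 hn).1
          rw [dist_zero_right] at this
          gcongr
      _ ≤ _ := by
          rw [← Finset.mul_sum]
          gcongr
          exact he.sum_inner_products_le u
  obtain ⟨T, hT⟩ := cauchySeq_tendsto_of_complete hC
  refine ⟨T, isCompactOperator_of_tendsto hT (Eventually.of_forall hcomp), fun u => ?_⟩
  simp only [← hS]
  exact ((ContinuousLinearMap.apply ℂ E u).continuous.tendsto T).comp hT

/-- `H_ho + 1` has a compact right inverse. -/
theorem exists_oscillator_resolvent :
    ∃ R : L2 →L[ℂ] L2, IsCompactOperator R ∧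
      ∀ u, ∃ h : R u ∈ oscillator.domain, oscillator ⟨R u, h⟩ + R u = u := by
  have hpos : ∀ n : ℕ, (n : ℂ) + 3 / 2 ≠ 0 := fun n h => by
    have := congrArg Complex.re h
    norm_num at this
    have h2 := n.cast_nonneg (α := ℝ)
    linarith
  have ha : Tendsto (fun n : ℕ => ((n : ℂ) + 3 / 2)⁻¹) atTop (𝓝 0) := by
    have h1 : Tendsto (fun n : ℕ => ((n : ℝ) + 3 / 2)⁻¹) atTop (𝓝 0) :=
      tendsto_inv_atTop_zero.comp
        (tendsto_atTop_add_const_right _ _ tendsto_natCast_atTop_atTop)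
    have h2 := (Complex.continuous_ofReal.tendsto 0).comp h1
    simpa [Function.comp_def] using h2
  obtain ⟨R, hR, hlim⟩ := exists_isCompactOperator_diagonal orthonormal_hermFun ha
  refine ⟨R, hR, fun u => ?_⟩
  let b : ℕ → ℂ := fun n => ((n : ℂ) + 3 / 2)⁻¹ * inner ℂ (hermFun n) u
  obtain ⟨h, e, -⟩ := oscillator_of_tendsto one_pos
    (P := fun N => ∑ n ∈ Finset.range N, b n • hermNormal n) (f := R u) (u := u - R u)
    (by simpa only [gaussPoly_sum_hermNormal] using hlim u)
    (by
      have h3 := (tendsto_sum_hermFun u).sub (hlim u)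
      simp only [gaussPoly_oscPoly_sum_hermNormal]
      refine h3.congr fun N => ?_
      rw [← Finset.sum_sub_distrib]
      refine Finset.sum_congr rfl fun n _ => ?_
      rw [← sub_smul]
      congr 1
      simp only [b]
      linear_combination -(inner ℂ (hermFun n) u) * inv_mul_cancel₀ (hpos n))
  exact ⟨h, by rw [e, sub_add_cancel]⟩

/-! ### Operators with compact resolvent -/

theorem pointSpec_subset_spec (A : L2 →ₗ.[ℂ] L2) : pointSpec A ⊆ spec A := by
  rintro z ⟨f, hf0, hf⟩ ⟨R, -, hR⟩
  refine hf0 ?_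
  rw [← hR f, hf, sub_self, map_zero]

/-- An operator with non-empty resolvent set is closed. -/
theorem IsResolventAt.isClosed {A : L2 →ₗ.[ℂ] L2} {z : ℂ} {R : L2 →L[ℂ] L2}
    (h : IsResolventAt A z R) : A.IsClosed := by
  have hg : (A.graph : Set (L2 × L2)) = {p | R (p.2 - z • p.1) = p.1} := by
    ext p
    simp only [SetLike.mem_coe, LinearPMap.mem_graph_iff, Set.mem_ofPred_eq]
    constructor
    · rintro ⟨f, h1, h2⟩
      rw [← h1, ← h2]
      exact h.2 f
    · intro hp
      obtain ⟨h1, h2⟩ := h.1 (p.2 - z • p.1)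
      refine ⟨⟨_, h1⟩, hp, ?_⟩
      have h3 : z • R (p.2 - z • p.1) = z • p.1 := congrArg (z • ·) hp
      rw [h3] at h2
      exact sub_left_injective h2
  change _root_.IsClosed (A.graph : Set (L2 × L2))
  rw [hg]
  exact isClosed_eq (by fun_prop) (by fun_prop)

/-- For an operator with compact resolvent, the Fredholm alternative shows that every point of the
spectrum is an eigenvalue. -/
theorem HasCompactResolvent.spec_subset_pointSpec {A : L2 →ₗ.[ℂ] L2}
    (hA : HasCompactResolvent A) : spec A ⊆ pointSpec A := by
  obtain ⟨z₀, R, hR, hc⟩ := hA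
  intro z hz
  have hne : z - z₀ ≠ 0 := by
    rw [sub_ne_zero]
    rintro rfl
    exact hz ⟨R, hR⟩
  rcases hc.hasEigenvalue_or_mem_resolventSet (inv_ne_zero hne) with h | h
  · obtain ⟨f, hf⟩ := h.exists_hasEigenvector
    have hRf : R f = (z - z₀)⁻¹ • f := hf.apply_eq_smul
    obtain ⟨h1, h2⟩ := hR.1 f
    refine ⟨⟨R f, h1⟩, ?_, ?_⟩
    · change R f ≠ 0
      rw [hRf]
      exact smul_ne_zero (inv_ne_zero hne) hf.2
    · have h3 : (z - z₀) • R f = f := by rw [hRf, smul_inv_smul₀ hne]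
      have h4 : A ⟨R f, h1⟩ = f + z₀ • R f := eq_add_of_sub_eq h2
      change _ = z • R f
      rw [sub_smul] at h3
      rw [h4, ← sub_eq_iff_eq_add.1 h3]
  · -- here `1 - (z - z₀) R` is invertible, and `(A - z)⁻¹ = R (1 - (z - z₀) R)⁻¹`
    exfalso
    refine hz ?_
    obtain ⟨S, hS⟩ := spectrum.mem_resolventSet_iff.1 h
    let B : L2 →L[ℂ] L2 := ((S⁻¹ : (L2 →L[ℂ] L2)ˣ) : L2 →L[ℂ] L2)
    have hSu : ∀ u, (S : L2 →L[ℂ] L2) u = (z - z₀)⁻¹ • u - R u := fun u => by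
      rw [hS, sub_apply, Algebra.algebraMap_eq_smul_one]
      rfl
    have hSB : ∀ u, (S : L2 →L[ℂ] L2) (B u) = u := fun u => by
      have := congrArg (fun T : L2 →L[ℂ] L2 => T u) S.mul_inv
      exact this
    have hBS : ∀ u, B ((S : L2 →L[ℂ] L2) u) = u := fun u => by
      have := congrArg (fun T : L2 →L[ℂ] L2 => T u) S.inv_mul
      exact this
    have hcomm : ∀ u, R (B u) = B (R u) := by
      intro u
      rw [← hBS (R (B u)), hSu, ← map_smul, ← map_sub, ← hSu, hSB]
    refine ⟨(z - z₀)⁻¹ • R ∘L B, fun u => ?_, fun f => ?_⟩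
    · obtain ⟨h1, h2⟩ := hR.1 ((z - z₀)⁻¹ • B u)
      have e : ((z - z₀)⁻¹ • R ∘L B) u = R ((z - z₀)⁻¹ • B u) := by
        rw [map_smul]; rfl
      rw [e]
      refine ⟨h1, ?_⟩
      have h4 : A ⟨_, h1⟩ = (z - z₀)⁻¹ • B u + z₀ • R ((z - z₀)⁻¹ • B u) := eq_add_of_sub_eq h2
      have h5 := hSB u
      rw [hSu] at h5
      have h6 : (z - z₀) • R ((z - z₀)⁻¹ • B u) = R (B u) := by
        rw [map_smul, smul_inv_smul₀ hne]
      calc _ = (z - z₀)⁻¹ • B u - (z - z₀) • R ((z - z₀)⁻¹ • B u) := by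
            rw [h4, sub_smul]; abel
        _ = u := by rw [h6, h5]
    · have h1 := hR.2 f
      have h2 : A f - z • (f : L2) = (A f - z₀ • (f : L2)) - (z - z₀) • (f : L2) := by
        rw [sub_smul]; abel
      change (z - z₀)⁻¹ • R (B (A f - z • (f : L2))) = f
      have h3 : (S : L2 →L[ℂ] L2) (f : L2) = (z - z₀)⁻¹ • R (A f - z • (f : L2)) := by
        rw [hSu, h2, map_sub, h1, map_smul, smul_sub, inv_smul_smul₀ hne]
      rw [hcomm, ← map_smul, ← h3, hBS]

/-! ### The Hamiltonian and its real part -/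

theorem hamiltonian_domain (γ : ℝ) : (hamiltonian γ).domain = oscillator.domain :=
  inf_eq_left.2 (oscillator_domain_le_pert γ)

theorem hamiltonian_apply (γ : ℝ) {f : L2} (hf : f ∈ (hamiltonian γ).domain) :
    hamiltonian γ ⟨f, hf⟩ = oscillator ⟨f, hf.1⟩ + pert γ ⟨f, hf.2⟩ := rfl

theorem dense_oscillator_domain : Dense (oscillator.domain : Set L2) := by
  have h : Submodule.span ℂ (Set.range hermFun) ≤ oscillator.domain := by
    refine Submodule.span_le.2 ?_
    rintro _ ⟨n, rfl⟩
    exact (oscillator_gaussPoly one_pos _).1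
  refine Dense.mono h (Submodule.dense_iff_topologicalClosure_eq_top.2 ?_)
  exact Submodule.topologicalClosure_eq_top_iff.2 orthogonal_span_hermFun

theorem inner_gaussPoly_hamiltonian {c : ℝ} (hc : 0 < c) (γ : ℝ) (P : ℂ[X]) {f : L2}
    (hf : f ∈ (hamiltonian γ).domain) :
    inner ℂ (gaussPoly hc P) (hamiltonian γ ⟨f, hf⟩)
      = inner ℂ (gaussPoly hc (oscPoly c P + pertPoly c (-γ) P)) f := by
  rw [hamiltonian_apply, inner_add_right, inner_gaussPoly_oscillator, inner_gaussPoly_pert,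
    map_add, inner_add_left]

theorem hamiltonian_isFormalAdjoint (γ : ℝ) :
    (hamiltonian γ).IsFormalAdjoint (hamiltonian (-γ)) := by
  refine LinearPMap.IsFormalAdjoint.symm ?_
  rintro ⟨g, hg⟩ ⟨f, hf⟩
  obtain ⟨P, h1, h2⟩ := exists_tendsto_gaussPoly hg.1
  obtain ⟨-, -, h⟩ := oscillator_of_tendsto one_pos h1 h2
  obtain ⟨_, h3⟩ := h (-γ)
  refine tendsto_nhds_unique (f := fun n => inner ℂ (gaussPoly one_pos
    (oscPoly 1 (P n) + pertPoly 1 (-γ) (P n))) f) (l := atTop) ?_ ?_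
  · simp only [map_add]
    exact (h2.add h3).inner tendsto_const_nhds
  · simp only [← inner_gaussPoly_hamiltonian one_pos γ _ hf]
    exact h1.inner tendsto_const_nhds

theorem pert_neg_apply (γ : ℝ) {f : L2} (hf : f ∈ (pert γ).domain)
    (hf' : f ∈ (pert (-γ)).domain) : pert (-γ) ⟨f, hf'⟩ = -pert γ ⟨f, hf⟩ := by
  obtain ⟨f₁, r, h1, hr, e⟩ := exists_pert_apply γ hf
  obtain ⟨_, e'⟩ := pert_eq (-γ) h1 hr
  rw [e, e', ← neg_smul, Complex.ofReal_neg]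

/-- On the common domain, `H* = H_ho - V`. -/
theorem realPart_hamiltonian (γ : ℝ) : realPart (hamiltonian γ) = oscillator := by
  have hd : Dense ((hamiltonian γ).domain : Set L2) := by
    rw [hamiltonian_domain]; exact dense_oscillator_domain
  have hle : hamiltonian (-γ) ≤ (hamiltonian γ).adjoint :=
    (hamiltonian_isFormalAdjoint γ).le_adjoint hd
  have hdom : (hamiltonian γ).domain ≤ (hamiltonian (-γ)).domain := by
    rw [hamiltonian_domain, hamiltonian_domain]
  refine LinearPMap.ext (?_ : (hamiltonian γ).domain ⊓ (hamiltonian γ).adjoint.domain = _) ?_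
  · rw [inf_eq_left.2 (hdom.trans hle.1), hamiltonian_domain]
  · intro f hf hf'
    have h1 : f ∈ (hamiltonian γ).domain := hf.1
    have h2 := hdom h1
    have h3 : (hamiltonian γ).adjoint ⟨f, hf.2⟩ = hamiltonian (-γ) ⟨f, h2⟩ :=
      (hle.2 (x := ⟨f, h2⟩) (y := ⟨f, hf.2⟩) rfl).symm
    change (1 / 2 : ℂ) • (hamiltonian γ ⟨f, h1⟩ + (hamiltonian γ).adjoint ⟨f, hf.2⟩) = _
    rw [h3, hamiltonian_apply, hamiltonian_apply, pert_neg_apply γ h1.2 h2.2, add_add_add_comm,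
      add_neg_cancel, add_zero, ← two_smul ℂ, smul_smul]
    norm_num

/-! ### Relative boundedness and compact resolvent -/

theorem boundedWith_pert_oscillator (γ : ℝ) : BoundedWith (pert γ) oscillator |γ| := by
  refine ⟨abs_nonneg γ, |γ|, abs_nonneg γ, fun f hA hB => ?_⟩
  refine abs_le_of_sq_le_sq' ((norm_sq_pert_le γ hA hB).trans ?_) (by positivity) |>.2
  rw [← mul_add, mul_pow, sq_abs]
  refine mul_le_mul_of_nonneg_left ?_ (sq_nonneg γ)
  have := mul_nonneg (norm_nonneg (oscillator ⟨f, hA⟩)) (norm_nonneg f)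
  nlinarith

theorem relativeBound_pert_oscillator_le (γ : ℝ) : relativeBound (pert γ) oscillator ≤ |γ| :=
  csInf_le ⟨0, fun _ ha => ha.1⟩ (boundedWith_pert_oscillator γ)

theorem norm_sq_pert_le_oscillator_add (γ : ℝ) {f : L2} (hf : f ∈ oscillator.domain)
    (hf' : f ∈ (pert γ).domain) :
    ‖pert γ ⟨f, hf'⟩‖ ^ 2 ≤ γ ^ 2 * ‖oscillator ⟨f, hf⟩ + f‖ ^ 2 :=
  (norm_sq_pert_le γ hf hf').trans
    (mul_le_mul_of_nonneg_left (norm_sq_oscillator_add_le hf) (sq_nonneg γ))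

/-- `H + 1` is injective since `‖V f‖ ≤ |γ| ‖(H_ho + 1) f‖` with `|γ| < 1`. -/
theorem hamiltonian_add_injective {γ : ℝ} (hγ : |γ| < 1) {f : L2}
    (hf : f ∈ (hamiltonian γ).domain) (h : hamiltonian γ ⟨f, hf⟩ + f = 0) : f = 0 := by
  have h1 := norm_sq_pert_le_oscillator_add γ hf.1 hf.2
  have h2 : pert γ ⟨f, hf.2⟩ = -(oscillator ⟨f, hf.1⟩ + f) := by
    rw [hamiltonian_apply, add_right_comm] at h
    exact eq_neg_of_add_eq_zero_right h
  rw [h2, norm_neg] at h1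
  have h3 : γ ^ 2 < 1 := (sq_lt_one_iff_abs_lt_one γ).2 hγ
  have h4 := norm_sq_oscillator_add_le hf.1
  have h5 := sq_nonneg ‖oscillator ⟨f, hf.1⟩‖
  have h6 : ‖f‖ ^ 2 ≤ 0 := by nlinarith [sq_nonneg ‖oscillator ⟨f, hf.1⟩ + f‖]
  exact norm_eq_zero.1 (pow_eq_zero_iff two_ne_zero |>.1 (le_antisymm h6 (sq_nonneg _)))

/-- With `R₁ = (H_ho + 1)⁻¹` one has `‖V R₁‖ ≤ |γ| < 1`, so that
`(H + 1)⁻¹ = R₁ (1 + V R₁)⁻¹` by the Neumann series. -/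
theorem hasCompactResolvent_hamiltonian {γ : ℝ} (hγ : |γ| < 1) :
    HasCompactResolvent (hamiltonian γ) := by
  obtain ⟨R₁, hc, hR⟩ := exists_oscillator_resolvent
  have hmem : ∀ u, R₁ u ∈ oscillator.domain := fun u => (hR u).1
  have hosc : ∀ u, oscillator ⟨R₁ u, hmem u⟩ + R₁ u = u := fun u => (hR u).2
  have hmem' : ∀ u, R₁ u ∈ (pert γ).domain := fun u => oscillator_domain_le_pert γ (hmem u)
  let K₀ : L2 →ₗ[ℂ] L2 := (pert γ).toFun ∘ₗ (R₁ : L2 →ₗ[ℂ] L2).codRestrict _ hmem'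
  have hK₀ : ∀ u, ‖K₀ u‖ ≤ |γ| * ‖u‖ := fun u => by
    refine abs_le_of_sq_le_sq' ?_ (by positivity) |>.2
    have h := norm_sq_pert_le_oscillator_add γ (hmem u) (hmem' u)
    rw [hosc] at h
    rw [mul_pow, sq_abs]
    exact h
  let K : L2 →L[ℂ] L2 := K₀.mkContinuous |γ| hK₀
  have hK : ∀ u, K u = pert γ ⟨R₁ u, hmem' u⟩ := fun _ => rfl
  have hKn : ‖-K‖ < 1 := by
    rw [norm_neg]
    exact (K₀.mkContinuous_norm_le (abs_nonneg γ) hK₀).trans_lt hγ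
  obtain ⟨S, hS⟩ := isUnit_one_sub_of_norm_lt_one hKn
  let B : L2 →L[ℂ] L2 := ((S⁻¹ : (L2 →L[ℂ] L2)ˣ) : L2 →L[ℂ] L2)
  have hSB : ∀ u, B u + K (B u) = u := fun u => by
    have h1 : (S : L2 →L[ℂ] L2) (B u) = u := congrArg (fun T : L2 →L[ℂ] L2 => T u) S.mul_inv
    rw [hS, sub_neg_eq_add] at h1
    exact h1
  have hright : ∀ u, ∃ h : (R₁ ∘L B) u ∈ (hamiltonian γ).domain,
      hamiltonian γ ⟨(R₁ ∘L B) u, h⟩ + (R₁ ∘L B) u = u := fun u => by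
    refine ⟨⟨hmem _, hmem' _⟩, ?_⟩
    change oscillator ⟨R₁ (B u), hmem _⟩ + pert γ ⟨R₁ (B u), hmem' _⟩ + R₁ (B u) = u
    rw [add_right_comm, hosc, ← hK, hSB]
  refine ⟨-1, R₁ ∘L B, ⟨fun u => ?_, fun f => ?_⟩, hc.comp_clm B⟩
  · obtain ⟨h1, h2⟩ := hright u
    exact ⟨h1, by rw [neg_one_smul, sub_neg_eq_add, h2]⟩
  · rw [neg_one_smul, sub_neg_eq_add]
    obtain ⟨h1, h2⟩ := hright (hamiltonian γ f + f)
    rw [← sub_eq_zero]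
    refine hamiltonian_add_injective hγ ((hamiltonian γ).domain.sub_mem h1 f.2) ?_
    have h3 : hamiltonian γ ⟨_, (hamiltonian γ).domain.sub_mem h1 f.2⟩
        = hamiltonian γ ⟨_, h1⟩ - hamiltonian γ f :=
      (hamiltonian γ).map_sub ⟨_, h1⟩ f
    rw [h3, sub_add_sub_comm, h2, sub_self]

/-! ### The spectrum of the Hamiltonian -/

/-- The eigenfunctions of `H_{-γ}`, which is contained in the adjoint of `H_γ`. They are complete,
and testing against them determines the spectrum. -/
theorem exists_complete_adjoint_eigenfunctions (γ : ℝ) :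
    ∃ w : ℝ, 0 < w ∧ ∃ φ : ℕ → L2, (∀ f : L2, (∀ n, inner ℂ (φ n) f = 0) → f = 0) ∧
      ∀ (n : ℕ) (f : (hamiltonian γ).domain),
        inner ℂ (φ n) (hamiltonian γ f) = (w * (n + 1 / 2) : ℂ) * inner ℂ (φ n) (f : L2) := by
  have hsq : √(1 + γ ^ 2) ^ 2 = 1 + γ ^ 2 := Real.sq_sqrt (by positivity)
  have hw : 0 < √(1 + γ ^ 2) := Real.sqrt_pos.2 (by positivity)
  have hc : 0 < √(1 + γ ^ 2) + -γ := by
    have : |γ| < √(1 + γ ^ 2) := Real.lt_sqrt_of_sq_lt (by rw [sq_abs]; linarith)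
    linarith [le_abs_self γ]
  refine ⟨√(1 + γ ^ 2), hw, fun n => gaussPoly hc (hermPoly (1 / (4 * √(1 + γ ^ 2))) n),
    fun f hf => eq_zero_of_inner_hermPoly_eq_zero hc _ hf, ?_⟩
  rintro n ⟨f, hf⟩
  rw [inner_gaussPoly_hamiltonian hc, oscPoly_add_pertPoly_hermPoly hw (by rw [hsq, neg_sq]),
    map_smul, inner_smul_left]
  simp only [map_mul, map_add, map_natCast, map_div₀, map_one, map_ofNat, Complex.conj_ofReal]

theorem hasPurelyDiscreteSpectrum_hamiltonian {γ : ℝ} (hγ : |γ| < 1) :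
    HasPurelyDiscreteSpectrum (hamiltonian γ) := by
  obtain ⟨w, hw, φ, hφ, hH⟩ := exists_complete_adjoint_eigenfunctions γ
  have hsub := (hasCompactResolvent_hamiltonian hγ).spec_subset_pointSpec
  have hev : ∀ z ∈ spec (hamiltonian γ), ∃ n : ℕ, z = (w * (n + 1 / 2) : ℂ) := by
    intro z hz
    obtain ⟨f, hf0, hf⟩ := hsub hz
    by_contra! hne
    refine hf0 (hφ _ fun n => ?_)
    have h1 := hH n f
    rw [hf, inner_smul_right] at h1
    exact (mul_eq_zero.1 (by linear_combination h1 :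
      (z - w * (n + 1 / 2)) * inner ℂ (φ n) (f : L2) = 0)).resolve_left (sub_ne_zero.2 (hne n))
  have hw0 : (w : ℂ) ≠ 0 := by exact_mod_cast hw.ne'
  intro z hz
  obtain ⟨m, rfl⟩ := hev z hz
  refine ⟨⟨w, hw, fun z' hz' hlt => ?_⟩, hsub hz, ?_⟩
  · obtain ⟨n, rfl⟩ := hev z' hz'
    have h1 : (w * (n + 1 / 2) : ℂ) - w * (m + 1 / 2)
        = ((w * ((n : ℤ) - (m : ℤ) : ℤ) : ℝ) : ℂ) := by
      push_cast
      ring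
    rw [h1, Complex.norm_real, norm_mul, Real.norm_of_nonneg hw.le,
      mul_lt_iff_lt_one_right hw, Real.norm_eq_abs, ← Int.cast_abs] at hlt
    have h2 : |(n : ℤ) - m| < 1 := by exact_mod_cast hlt
    have h3 : n = m := by
      rw [Int.abs_lt_one_iff] at h2
      omega
    rw [h3]
  · -- generalized eigenvectors are orthogonal to all `φ n` with `n ≠ m`
    have hker : ∀ k, ∀ f ∈ kerPow (hamiltonian γ) (w * (m + 1 / 2)) k, ∀ n, n ≠ m →
        inner ℂ (φ n) f = 0 := by
      intro k
      induction k with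
      | zero =>
        intro f hf n _
        rw [(Submodule.mem_bot ℂ).1 hf, inner_zero_right]
      | succ k ih =>
        rintro _ ⟨f, hf, rfl⟩ n hn
        have h1 : inner ℂ (φ n) (hamiltonian γ f - (w * (m + 1 / 2) : ℂ) • (f : L2)) = 0 :=
          ih _ hf n hn
        rw [inner_sub_right, inner_smul_right, hH] at h1
        have h2 : (w : ℂ) * (n - m) ≠ 0 :=
          mul_ne_zero hw0 (sub_ne_zero.2 (by exact_mod_cast hn))
        exact (mul_eq_zero.1 (by linear_combination h1 :
          ((w : ℂ) * (n - m)) * inner ℂ (φ n) (f : L2) = 0)).resolve_left h2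
    have hroot : rootSpace (hamiltonian γ) (w * (m + 1 / 2))
        ≤ (Submodule.span ℂ (φ '' {m}ᶜ))ᗮ := by
      refine iSup_le fun k f hf => ?_
      rw [Submodule.mem_orthogonal]
      intro g hg
      induction hg using Submodule.span_induction with
      | mem x hx => obtain ⟨n, hn, rfl⟩ := hx; exact hker k f hf n hn
      | zero => exact inner_zero_left _
      | add x y _ _ hx hy => rw [inner_add_left, hx, hy, add_zero]
      | smul a x _ hx => rw [inner_smul_left, hx, mul_zero]
    refine Module.Finite.of_injective ((innerₛₗ ℂ (φ m)).domRestrict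
      (rootSpace (hamiltonian γ) (w * (m + 1 / 2)))) ?_
    rw [injective_iff_map_eq_zero]
    rintro ⟨f, hf⟩ h0
    have h1 : inner ℂ (φ m) f = 0 := h0
    refine Subtype.ext (hφ f fun n => ?_)
    by_cases hn : n = m
    · rw [hn, h1]
    · exact (Submodule.mem_orthogonal _ _).1 (hroot hf) _
        (Submodule.subset_span ⟨n, hn, rfl⟩)

end Swanson

end

theorem mainTheorem4 (γ : ℝ) (hγ : |γ| < 1) :
    ((Swanson.hamiltonian γ).domain : Set Swanson.L2) = Swanson.domD ∧
    Dense ((Swanson.hamiltonian γ).domain : Set Swanson.L2) ∧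
    Swanson.realPart (Swanson.hamiltonian γ) = Swanson.oscillator ∧
    Swanson.RelativelyBounded (Swanson.pert γ) (Swanson.realPart (Swanson.hamiltonian γ)) ∧
    Swanson.relativeBound (Swanson.pert γ) (Swanson.realPart (Swanson.hamiltonian γ)) < 1 ∧
    (Swanson.hamiltonian γ).IsClosed ∧
    Swanson.HasCompactResolvent (Swanson.hamiltonian γ) ∧
    Swanson.spec (Swanson.hamiltonian γ) = Swanson.pointSpec (Swanson.hamiltonian γ) ∧
    Swanson.HasPurelyDiscreteSpectrum (Swanson.hamiltonian γ) := by
  have hc := Swanson.hasCompactResolvent_hamiltonian hγ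
  rw [Swanson.realPart_hamiltonian, Swanson.hamiltonian_domain]
  refine ⟨Swanson.oscillator_domain, Swanson.dense_oscillator_domain, rfl,
    ⟨Swanson.oscillator_domain_le_pert γ, _, Swanson.boundedWith_pert_oscillator γ⟩,
    (Swanson.relativeBound_pert_oscillator_le γ).trans_lt hγ, ?_, hc,
    hc.spec_subset_pointSpec.antisymm (Swanson.pointSpec_subset_spec _),
    Swanson.hasPurelyDiscreteSpectrum_hamiltonian hγ⟩
  obtain ⟨_, _, h, -⟩ := hc
  exact h.isClosed
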